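/- Let $m\ge 1$, $n\ge 0$, and let $\mathcal M=\{A,B,C,D\}$ with $A\in\mathbb C^{n\times n}$, $B\in\mathbb C^{n\times m}$, $C\in\mathbb C^{m\times n}$, $D\in\mathbb C^{m\times m}$ denote the system $\dot x=Ax+Bu$, $y=Cx+Du$. Assume that $\mathcal M$ is minimal, i.e. $\operatorname{rank}[\,sI_n-A\mid B\,]=n$ and $\operatorname{rank}[\,sI_n-A^{\mathsf H}\mid C^{\mathsf H}\,]=n$ for all $s\in\mathbb C$. For Hermitian matrices $>$ and $\ge$ denote the positive (semi)definite order. A system $\{A,B,C,D\}$ with transfer function $\mathcal T(s)=C(sI_n-A)^{-1}B+D$ is called *passive* if there is a storage function $\mathcal H:\mathbb C^n\to[0,\infty)$ such that $\mathcal H(x(t_1))-\mathcal H(x(t_0))\le\int_{t_0}^{t_1}\operatorname{Re}(y(t)^{\mathsf H}u(t))\,dt$ for all $t_0<t_1$ and all trajectories with locally square-integrable $u$. It is called *strictly passive* if all eigenvalues of $A$ lie in the open left half plane, $\mathcal T(i\omega)^{\mathsf H}+\mathcal T(i\omega)>0$ for all $\omega\in\mathbb R$, and $D^{\mathsf H}+D>0$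 (the condition at $\omega=\infty$). For Hermitian $X\in\mathbb C^{n\times n}$ put $$W(X,\mathcal M)=\begin{bmatrix}-A^{\mathsf H}X-XA & C^{\mathsf H}-XB\\ C-B^{\mathsf H}X & D^{\mathsf H}+D\end{bmatrix}.$$ For $\xi\in\mathbb R$ let $\mathcal M_\xi=\{A+\tfrac{\xi}{2}I_n,\,B,\,C,\,D-\tfrac{\xi}{2}I_m\}$, with transfer function $\mathcal T_\xi$; $\mathcal T_\xi$ is called (strictly) passive if $\mathcal M_\xi$ is. **Theorem.** Suppose that $\mathcal M$ is strictly passive. Then $\Xi:=\sup\{\xi\in\mathbb R\mid \mathcal T_\xi\text{ is strictly passive}\}$ is finite, and 1. $\mathcal T_\Xi$ is passive; 2. there is a Hermitian $X>0$ with $W(X,\mathcal M_\Xi)\ge0$; 3. there is no Hermitian $X$ with $W(X,\mathcal M_\Xi)>0$; 4. for every real $\xi<\Xi$ there is a Hermitian $X>0$ with $W(X,\mathcal M_\xi)>0$; 5. for every Hermitian $X>0$ with $W(X,\mathcal M)\ge0$ the maximum $\xi^*(X):=\max\{\xi\in\mathbb R\mid W(X,\mathcal M)\ge\xi\,\operatorname{diag}(X,I_m)\}$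 exists, and $\Xi$ is the supremum of $\xi^*(X)$ over all such $X$. -/

import Mathlib

open MeasureTheory
open scoped Matrix ComplexOrder

/-- A continuous-time linear time-invariant system `ẋ = A x + B u`, `y = C x + D u` with
`n` states, `m` inputs and `m` outputs, and complex coefficient matrices. -/
structure LTISystem (n m : ℕ) where
  A : Matrix (Fin n) (Fin n) ℂ
  B : Matrix (Fin n) (Fin m) ℂ
  C : Matrix (Fin m) (Fin n) ℂ
  D : Matrix (Fin m) (Fin m) ℂ

/-- `(A, B)` is controllable: `rank [s I - A | B] = n` for every complex `s`. -/
def IsControllablePair {n m : ℕ} (A : Matrix (Fin n) (Fin n) ℂ)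
    (B : Matrix (Fin n) (Fin m) ℂ) : Prop :=
  ∀ s : ℂ, (Matrix.fromCols (s • (1 : Matrix (Fin n) (Fin n) ℂ) - A) B).rank = n

namespace LTISystem

variable {n m : ℕ}

/-- Minimality: `(A, B)` is controllable and `(A, C)` is observable, the latter meaning that
`(Aᴴ, Cᴴ)` is controllable. -/
def IsMinimal (M : LTISystem n m) : Prop :=
  IsControllablePair M.A M.B ∧ IsControllablePair M.Aᴴ M.Cᴴ

/-- The transfer function `T(s) = C (s I - A)⁻¹ B + D`. -/
noncomputable def transfer (M : LTISystem n m) (s : ℂ) : Matrix (Fin m) (Fin m) ℂ :=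
  M.C * (s • (1 : Matrix (Fin n) (Fin n) ℂ) - M.A)⁻¹ * M.B + M.D

/-- `Φ(i ω) = T(i ω)ᴴ + T(i ω)`: the function `Φ` on the imaginary axis. -/
noncomputable def popov (M : LTISystem n m) (ω : ℝ) : Matrix (Fin m) (Fin m) ℂ :=
  (M.transfer (Complex.I * ω))ᴴ + M.transfer (Complex.I * ω)

/-- Asymptotic stability: every eigenvalue of `A` lies in the open left half plane. -/
def IsAsymptoticallyStable (M : LTISystem n m) : Prop :=
  ∀ s ∈ spectrum ℂ M.A, s.re < 0

/-- Strict passivity: asymptotic stability, together with positive definiteness of `Φ` on the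
imaginary axis with the point at infinity, where `Φ(∞) = Dᴴ + D`, included. -/
def IsStrictlyPassive (M : LTISystem n m) : Prop :=
  M.IsAsymptoticallyStable ∧ (∀ ω : ℝ, (M.popov ω).PosDef) ∧ (M.Dᴴ + M.D).PosDef

/-- `(x, u)` is a state/input trajectory: `u` is locally square-integrable and `x` is a
(Caratheodory) solution of `ẋ = A x + B u`. -/
structure IsTrajectory (M : LTISystem n m) (x : ℝ → Fin n → ℂ) (u : ℝ → Fin m → ℂ) : Prop where
  memLp_input : ∀ a b : ℝ, MemLp u 2 (volume.restrict (Set.Icc a b))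
  continuous_state : Continuous x
  state_eq : ∀ a b : ℝ, x b - x a = ∫ t in a..b, (M.A *ᵥ x t + M.B *ᵥ u t)

/-- The output `y = C x + D u`. -/
def output (M : LTISystem n m) (x : ℝ → Fin n → ℂ) (u : ℝ → Fin m → ℂ) (t : ℝ) : Fin m → ℂ :=
  M.C *ᵥ x t + M.D *ᵥ u t

/-- Passivity: there is a nonnegative storage function `V` of the state that satisfies the
dissipation inequality `V (x t₁) - V (x t₀) ≤ ∫ t in t₀..t₁, Re (y(t)ᴴ u(t))`
along all trajectories. -/
def IsPassive (M : LTISystem n m) : Prop :=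
  ∃ V : (Fin n → ℂ) → ℝ, (∀ z, 0 ≤ V z) ∧
    ∀ (x : ℝ → Fin n → ℂ) (u : ℝ → Fin m → ℂ), M.IsTrajectory x u →
      ∀ t₀ t₁ : ℝ, t₀ < t₁ →
        V (x t₁) - V (x t₀) ≤ ∫ t in t₀..t₁, (star (M.output x u t) ⬝ᵥ u t).re

/-- The matrix function `W(X, M)`. -/
def W (M : LTISystem n m) (X : Matrix (Fin n) (Fin n) ℂ) :
    Matrix (Fin n ⊕ Fin m) (Fin n ⊕ Fin m) ℂ :=
  Matrix.fromBlocks (-(M.Aᴴ * X) - X * M.A) (M.Cᴴ - X * M.B)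
    (M.C - M.Bᴴ * X) (M.Dᴴ + M.D)

/-- The set of all `X > 0` with `W(X, M) ≥ 0`. -/
def solSet (M : LTISystem n m) : Set (Matrix (Fin n) (Fin n) ℂ) :=
  {X | X.PosDef ∧ (M.W X).PosSemidef}

/-- The set of all `X > 0` with `W(X, M) > 0`. -/
def strictSolSet (M : LTISystem n m) : Set (Matrix (Fin n) (Fin n) ℂ) :=
  {X | X.PosDef ∧ (M.W X).PosDef}

/-- The shifted model `M_ξ = {A + (ξ/2) I, B, C, D - (ξ/2) I}`. Its transfer function is
`T_ξ(s) = C ((s - ξ/2) I - A)⁻¹ B + (D - (ξ/2) I)`. -/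
noncomputable def shift (M : LTISystem n m) (ξ : ℝ) : LTISystem n m where
  A := M.A + ((ξ / 2 : ℝ) : ℂ) • (1 : Matrix (Fin n) (Fin n) ℂ)
  B := M.B
  C := M.C
  D := M.D - ((ξ / 2 : ℝ) : ℂ) • (1 : Matrix (Fin m) (Fin m) ℂ)

/-- The set of all real `ξ` with `W(X, M) ≥ ξ diag(X, I)`. -/
def xiSet (M : LTISystem n m) (X : Matrix (Fin n) (Fin n) ℂ) : Set ℝ :=
  {ξ : ℝ | (M.W X - (ξ : ℂ) • Matrix.fromBlocks X 0 0 (1 : Matrix (Fin m) (Fin m) ℂ)).PosSemidef}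

/-- `ξ*(X)`, the largest `ξ` with `W(X, M) ≥ ξ diag(X, I)`; that the largest element exists is
asserted separately where `ξ*` is used. -/
noncomputable def xiStar (M : LTISystem n m) (X : Matrix (Fin n) (Fin n) ℂ) : ℝ :=
  sSup (M.xiSet X)

end LTISystem

/-!
Strict passivity of `M` is equivalent to strict feasibility of `W(X, M) > 0` over `X > 0`. If no
Hermitian `X` gave `W(X, M) > 0`, separating the affine space of all `W(X, M)` from the cone of
positive definite matrices would produce `Z = S Sᴴ ≠ 0` with `Re tr (W(X, M) Z) ≤ 0` for every
Hermitian `X`. The part linear in `X` must then vanish on `Z`, which lets one choose each column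
`(f, g)` of `S` either with `f = 0` or with `A f + B g = i ω f`, and on such a column `W` evaluates
to `gᴴ (Dᴴ + D) g` or `gᴴ Φ(i ω) g`, both positive. That `X > 0` is Lyapunov's theorem.

Since `W(X, M_ξ) = W(X, M) - ξ diag(X, I)`, feasibility at `ξ` passes to smaller shifts, strictly so
for `X > 0`. Controllability bounds the positive semidefinite solutions of `W(X, M_ξ) ≥ 0`,
uniformly for `ξ` in a bounded interval, and observability makes them definite, so there is a
largest feasible shift; this is `Ξ`.
-/

open Matrix
open scoped Topology

section PosDefOpen

variable {ι : Type*} [Finite ι]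

open scoped Matrix.Norms.L2Operator MatrixOrder in
theorem isClosed_setOf_posSemidef : IsClosed {Z : Matrix ι ι ℂ | Z.PosSemidef} := by
  cases nonempty_fintype ι
  classical
  simpa only [nonneg_iff_posSemidef] using CStarAlgebra.isClosed_nonneg (A := Matrix ι ι ℂ)

open scoped Matrix.Norms.L2Operator MatrixOrder in
theorem eventually_posDef_nhdsWithin_isHermitian {P : Matrix ι ι ℂ} (hP : P.PosDef) :
    ∀ᶠ Q in 𝓝[{Q | Q.IsHermitian}] P, Q.PosDef := by
  cases nonempty_fintype ι
  classical
  cases isEmpty_or_nonempty ι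
  · exact .of_forall fun Q => Subsingleton.elim P Q ▸ hP
  obtain ⟨c, hc, hcP⟩ := (CFC.exists_pos_algebraMap_le_iff hP.1.isSelfAdjoint).mpr
    fun x hx => hP.isStrictlyPositive.spectrum_pos hx
  filter_upwards [self_mem_nhdsWithin, mem_nhdsWithin_of_mem_nhds (Metric.ball_mem_nhds P hc)]
    with Q hQ hdist
  have hPQ : P - Q ≤ algebraMap ℝ (Matrix ι ι ℂ) ‖P - Q‖ :=
    IsSelfAdjoint.le_algebraMap_norm_self (hP.1.sub hQ).isSelfAdjoint
  have hle : algebraMap ℝ (Matrix ι ι ℂ) (c - ‖P - Q‖) ≤ Q := by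
    rw [map_sub, sub_le_iff_le_add, ← sub_le_iff_le_add']
    exact (sub_le_sub_right hcP Q).trans hPQ
  have hpos : (algebraMap ℝ (Matrix ι ι ℂ) (c - ‖P - Q‖)).PosDef := by
    rw [Algebra.algebraMap_eq_smul_one]
    exact PosDef.one.smul (sub_pos.mpr (by rwa [← dist_eq_norm, dist_comm]))
  exact (hpos.isStrictlyPositive.of_le hle).posDef

theorem eventually_posDef_add_smul {P Q : Matrix ι ι ℂ} (hP : P.PosDef) (hQ : Q.IsHermitian) :
    ∀ᶠ t : ℝ in 𝓝 0, (P + t • Q).PosDef := by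
  have hlim : Filter.Tendsto (fun t : ℝ => P + t • Q) (𝓝 0) (𝓝 P) := by
    have hcont : Continuous fun t : ℝ => P + t • Q := by fun_prop
    simpa using hcont.tendsto 0
  have hherm (t : ℝ) : (P + t • Q).IsHermitian := hP.1.add (hQ.smul (.all t))
  exact (tendsto_nhdsWithin_iff.mpr ⟨hlim, .of_forall hherm⟩).eventually
    (eventually_posDef_nhdsWithin_isHermitian hP)

theorem exists_pos_posDef_add_smul {P Q : Matrix ι ι ℂ} (hP : P.PosDef) (hQ : Q.IsHermitian) :
    ∃ t : ℝ, 0 < t ∧ (P + t • Q).PosDef ∧ (P + (-t) • Q).PosDef := by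
  have hneg : ∀ᶠ t : ℝ in 𝓝 0, (P + (-t) • Q).PosDef :=
    (continuous_neg.tendsto' (0 : ℝ) 0 neg_zero).eventually (eventually_posDef_add_smul hP hQ)
  obtain ⟨t, ht, ht0⟩ := (((eventually_posDef_add_smul hP hQ).and hneg).filter_mono
    nhdsWithin_le_nhds |>.and (self_mem_nhdsWithin (s := Set.Ioi (0 : ℝ)))).exists
  exact ⟨t, ht0, ht⟩

end PosDefOpen

section PosSemidef

variable {ι : Type*} [Fintype ι]

theorem posSemidef_iff_re_nonneg {P : Matrix ι ι ℂ} :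
    P.PosSemidef ↔ P.IsHermitian ∧ ∀ v, 0 ≤ (star v ⬝ᵥ P *ᵥ v).re := by
  rw [posSemidef_iff_dotProduct_mulVec]
  refine and_congr_right fun hP => forall_congr' fun v => ?_
  rw [Complex.nonneg_iff]
  exact and_iff_left (hP.im_star_dotProduct_mulVec_self v).symm

theorem posDef_iff_re_pos {P : Matrix ι ι ℂ} :
    P.PosDef ↔ P.IsHermitian ∧ ∀ v, v ≠ 0 → 0 < (star v ⬝ᵥ P *ᵥ v).re := by
  rw [posDef_iff_dotProduct_mulVec]
  refine and_congr_right fun hP => forall₂_congr fun v _ => ?_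
  rw [Complex.pos_iff]
  exact and_iff_left (hP.im_star_dotProduct_mulVec_self v).symm

open scoped MatrixOrder in
theorem exists_eq_mul_conjTranspose {Z : Matrix ι ι ℂ} (hZ : Z.PosSemidef) :
    ∃ S : Matrix ι ι ℂ, Z = S * Sᴴ := by
  classical
  exact CStarAlgebra.nonneg_iff_eq_mul_star_self.mp hZ.nonneg

open scoped Matrix.Norms.Frobenius in
theorem frobenius_norm_le_re_trace {Z : Matrix ι ι ℂ} (hZ : Z.PosSemidef) :
    ‖Z‖ ≤ Z.trace.re := by
  obtain ⟨S, rfl⟩ := exists_eq_mul_conjTranspose hZ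
  have htr : (S * Sᴴ).trace.re = ‖S‖ * ‖S‖ := by
    rw [frobenius_norm_def, ← Real.sqrt_eq_rpow, Real.mul_self_sqrt (by positivity)]
    simp only [trace, diag_apply, mul_apply, conjTranspose_apply, RCLike.star_def,
      Complex.mul_conj', Complex.re_sum, Real.rpow_ofNat]
    norm_cast
  calc ‖S * Sᴴ‖ ≤ ‖S‖ * ‖Sᴴ‖ := frobenius_norm_mul _ _
    _ = (S * Sᴴ).trace.re := by rw [frobenius_norm_conjTranspose, htr]

open scoped Matrix.Norms.Frobenius in
theorem isCompact_posSemidef_trace_le (R : ℝ) :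
    IsCompact {Z : Matrix ι ι ℂ | Z.PosSemidef ∧ Z.trace.re ≤ R} := by
  have hclosed : IsClosed {Z : Matrix ι ι ℂ | Z.trace.re ≤ R} :=
    isClosed_le (Complex.continuous_re.comp continuous_id.matrix_trace) continuous_const
  refine (isCompact_closedBall 0 R).of_isClosed_subset
    (isClosed_setOf_posSemidef.inter hclosed) fun Z hZ => ?_
  exact mem_closedBall_zero_iff.mpr ((frobenius_norm_le_re_trace hZ.1).trans hZ.2)

end PosSemidef

section Spectraplex

variable {ι κ : Type*} [Fintype ι]

/-- The spectraplex: positive semidefinite matrices of trace one. It is a compact base of the cone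
of positive semidefinite matrices, over which its linear functionals are tested. -/
def spectraplex (ι : Type*) [Fintype ι] : Set (Matrix ι ι ℂ) :=
  {Z | Z.PosSemidef ∧ Z.trace.re = 1}

theorem isCompact_spectraplex : IsCompact (spectraplex ι) := by
  have hclosed : IsClosed {Z : Matrix ι ι ℂ | Z.trace.re = 1} :=
    isClosed_eq (by fun_prop) continuous_const
  exact (isCompact_posSemidef_trace_le 1).of_isClosed_subset
    (isClosed_setOf_posSemidef.inter hclosed) fun Z hZ => ⟨hZ.1, hZ.2.le⟩

theorem convex_spectraplex : Convex ℝ (spectraplex ι) := by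
  intro Y hY Z hZ a b ha hb hab
  refine ⟨(hY.1.smul ha).add (hZ.1.smul hb), ?_⟩
  simp [hY.2, hZ.2, hab]

theorem ne_zero_of_mem_spectraplex {Z : Matrix ι ι ℂ} (hZ : Z ∈ spectraplex ι) : Z ≠ 0 := by
  rintro rfl
  simpa using hZ.2

theorem re_trace_inv_smul_mem_spectraplex {Z : Matrix ι ι ℂ} (hZ : Z.PosSemidef)
    (hpos : 0 < Z.trace.re) : Z.trace.re⁻¹ • Z ∈ spectraplex ι := by
  refine ⟨hZ.smul (inv_nonneg.mpr hpos.le), ?_⟩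
  simp [hpos.ne']

theorem posDef_of_forall_spectraplex {Y : Matrix ι ι ℂ} (hY : Y.IsHermitian)
    (h : ∀ Z ∈ spectraplex ι, 0 < (Y * Z).trace.re) : Y.PosDef := by
  refine posDef_iff_re_pos.mpr ⟨hY, fun v hv => ?_⟩
  have htr : 0 < (vecMulVec v (star v)).trace.re := by
    rw [trace_vecMulVec, dotProduct_comm]
    exact (Complex.pos_iff.mp (dotProduct_star_self_pos_iff.mpr hv)).1
  have hpos := h _ (re_trace_inv_smul_mem_spectraplex (posSemidef_vecMulVec_self_star v) htr)
  rw [mul_smul_comm, trace_smul, Complex.smul_re, smul_eq_mul] at hpos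
  have := pos_of_mul_pos_right hpos (inv_nonneg.mpr htr.le)
  rwa [mul_vecMulVec, trace_vecMulVec, dotProduct_comm] at this

theorem exists_re_trace_le_of_recession [Finite κ] (P : Matrix κ κ ℂ)
    (𝓛 : Matrix ι ι ℂ →ₗ[ℝ] Matrix κ κ ℂ)
    (h : ∀ Z, Z.PosSemidef → (𝓛 Z).PosSemidef → Z = 0) :
    ∃ R : ℝ, ∀ Z, Z.PosSemidef → (P + 𝓛 Z).PosSemidef → Z.trace.re ≤ R := by
  let S : Set (Matrix ι ι ℂ × ℝ) :=
    spectraplex ι ×ˢ Set.Icc 0 1 ∩ {q | (q.2 • P + 𝓛 q.1).PosSemidef}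
  have hcont : Continuous fun q : Matrix ι ι ℂ × ℝ => q.2 • P + 𝓛 q.1 := by
    have := 𝓛.continuous_of_finiteDimensional
    fun_prop
  have hS : IsCompact S := (isCompact_spectraplex.prod isCompact_Icc).inter_right
    (isClosed_setOf_posSemidef.preimage hcont)
  have hpos : ∀ q ∈ S, 0 < q.2 := by
    rintro ⟨Z, t⟩ ⟨⟨hZ, ht⟩, hPZ⟩
    refine ht.1.lt_of_ne' fun ht0 => ne_zero_of_mem_spectraplex hZ (h Z hZ.1 ?_)
    have ht0 : t = 0 := ht0
    simpa [ht0] using hPZ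
  obtain ⟨δ, hδ, hSδ⟩ := hS.exists_forall_le' continuous_snd.continuousOn hpos
  refine ⟨max 1 δ⁻¹, fun Z hZ hPZ => ?_⟩
  by_contra! hlt
  obtain ⟨h1, h2⟩ := max_lt_iff.mp hlt
  have htr : 0 < Z.trace.re := one_pos.trans h1
  have hmem : (Z.trace.re⁻¹ • Z, Z.trace.re⁻¹) ∈ S := by
    refine ⟨⟨re_trace_inv_smul_mem_spectraplex hZ htr, (inv_pos.mpr htr).le,
      inv_le_one_of_one_le₀ h1.le⟩, ?_⟩
    simpa using hPZ.smul (inv_pos.mpr htr).le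
  exact absurd (hSδ _ hmem) (not_le.mpr (inv_lt_of_inv_lt₀ hδ h2))

/-- The real trace pairing `(Y, Z) ↦ Re tr (Y Z)`. -/
noncomputable def tracePairing (ι : Type*) [Fintype ι] :
    Matrix ι ι ℂ →ₗ[ℝ] Matrix ι ι ℂ →ₗ[ℝ] ℝ :=
  (LinearMap.mul ℝ (Matrix ι ι ℂ)).compr₂ (Complex.reLm ∘ₗ traceLinearMap ι ℝ ℂ)

theorem tracePairing_apply (Y Z : Matrix ι ι ℂ) : tracePairing ι Y Z = (Y * Z).trace.re := rfl

theorem apply_pi_prod {d : Type*} [Fintype d] [DecidableEq d] (f : StrongDual ℝ ((d → ℝ) × ℝ))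
    (y : d → ℝ) (t : ℝ) : f (y, t) = ∑ j, y j * f (Pi.single j 1, 0) + t * f (0, 1) := by
  have hsplit : (y, t) = ∑ j, y j • (Pi.single j 1, (0 : ℝ)) + t • ((0 : d → ℝ), (1 : ℝ)) := by
    ext <;> simp [Prod.fst_sum, Prod.snd_sum, Pi.single_apply]
  rw [hsplit, map_add, map_sum]
  simp only [map_smul, smul_eq_mul]

theorem exists_nonneg_smul_add_posDef {E : Type*} [AddCommGroup E] [Module ℝ E]
    [FiniteDimensional ℝ E] {P : Matrix ι ι ℂ} (hP : P.IsHermitian) {𝓛 : E →ₗ[ℝ] Matrix ι ι ℂ}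
    (h𝓛 : ∀ X, (𝓛 X).IsHermitian)
    (h : ∀ Z ∈ spectraplex ι, (∀ X, tracePairing ι (𝓛 X) Z = 0) → 0 < tracePairing ι P Z) :
    ∃ c : ℝ, 0 ≤ c ∧ ∃ X, (c • P + 𝓛 X).PosDef := by
  let b := Module.finBasis ℝ E
  let Φ : Matrix ι ι ℂ →ₗ[ℝ] (Fin (Module.finrank ℝ E) → ℝ) × ℝ :=
    (LinearMap.pi fun j => tracePairing ι (𝓛 (b j))).prod (tracePairing ι P)
  have hdisj : Disjoint (Φ '' spectraplex ι) ({0} ×ˢ Set.Iic 0) := by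
    rw [Set.disjoint_left]
    rintro _ ⟨Z, hZ, rfl⟩ ⟨h0, hle⟩
    have hX : (tracePairing ι).flip Z ∘ₗ 𝓛 = 0 := b.ext (congrFun h0)
    exact (h Z hZ (LinearMap.congr_fun hX)).not_ge hle
  obtain ⟨f, u, v, hfu, huv, hvf⟩ := geometric_hahn_banach_compact_closed
    (convex_spectraplex.linear_image Φ)
    (isCompact_spectraplex.image Φ.continuous_of_finiteDimensional)
    ((convex_singleton _).prod (convex_Iic _)) (isClosed_singleton.prod isClosed_Iic) hdisj
  have hv : v < 0 := by simpa using hvf 0 (by simp)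
  have hc : f (0, 1) ≤ 0 := by
    by_contra! hc
    have := hvf (0, v / f (0, 1)) (by simp [div_nonpos_of_nonpos_of_nonneg hv.le hc.le])
    rw [apply_pi_prod, div_mul_cancel₀ _ hc.ne'] at this
    simp at this
  let X : E := ∑ j, -f (Pi.single j 1, 0) • b j
  have hpair (Z) : tracePairing ι (-f (0, 1) • P + 𝓛 X) Z = -f (Φ Z) := by
    rw [show f (Φ Z) = _ from apply_pi_prod f (fun j => tracePairing ι (𝓛 (b j)) Z) _]
    simp [X, mul_comm, add_comm]
  refine ⟨-f (0, 1), neg_nonneg.mpr hc, X, posDef_of_forall_spectraplex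
    ((hP.smul (.all _)).add (h𝓛 X)) fun Z hZ => ?_⟩
  rw [← tracePairing_apply, hpair]
  linarith [hfu _ ⟨Z, hZ, rfl⟩]

theorem exists_add_posDef {E : Type*} [AddCommGroup E] [Module ℝ E]
    [FiniteDimensional ℝ E] {P : Matrix ι ι ℂ} (hP : P.IsHermitian) {𝓛 : E →ₗ[ℝ] Matrix ι ι ℂ}
    (h𝓛 : ∀ X, (𝓛 X).IsHermitian)
    (h : ∀ Z ∈ spectraplex ι, (∀ X, tracePairing ι (𝓛 X) Z = 0) → 0 < tracePairing ι P Z) :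
    ∃ X, (P + 𝓛 X).PosDef := by
  obtain ⟨c, hc, X, hX⟩ := exists_nonneg_smul_add_posDef hP h𝓛 h
  obtain ⟨t, ht, hXt, -⟩ := exists_pos_posDef_add_smul hX hP
  have hct : 0 < c + t := by positivity
  refine ⟨(c + t)⁻¹ • X, ?_⟩
  convert hXt.smul (inv_pos.mpr hct) using 1
  rw [map_smul, add_right_comm, ← add_smul, smul_add, smul_smul, inv_mul_cancel₀ hct.ne', one_smul]

end Spectraplex

section SkewProduct

variable {ι κ : Type*} [Fintype κ]

theorem trace_mul_mul_conjTranspose [Fintype ι] (P : Matrix ι ι ℂ) (S T : Matrix ι κ ℂ) :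
    (P * (S * Tᴴ)).trace = ∑ k, star (T.col k) ⬝ᵥ P *ᵥ S.col k := by
  rw [← Matrix.mul_assoc, trace_mul_comm]
  rfl

theorem add_conjTranspose_eq_zero_of_re_trace_eq_zero {L : Matrix κ κ ℂ}
    (h : ∀ X : Matrix κ κ ℂ, X.IsHermitian → (X * L).trace.re = 0) : L + Lᴴ = 0 := by
  have hX := isHermitian_add_transpose_self L
  have htrace : (((L + Lᴴ)ᴴ * (L + Lᴴ)).trace).re = 0 := by
    have hconj : ((L + Lᴴ) * Lᴴ).trace = star ((L + Lᴴ) * L).trace := by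
      rw [← trace_conjTranspose, conjTranspose_mul, hX.eq, trace_mul_comm]
    rw [hX.eq, Matrix.mul_add, trace_add, hconj, Complex.add_re, Complex.star_def,
      Complex.conj_re, h _ hX, add_zero]
  rw [← trace_conjTranspose_mul_self_eq_zero_iff]
  have hnonneg := (posSemidef_conjTranspose_mul_self (L + Lᴴ)).trace_nonneg
  exact Complex.ext htrace (Complex.nonneg_iff.mp hnonneg).2.symm

/- The witness is `T = F * (Fᴴ * F)⁺`, so that `Fᴴ * T` is the orthogonal projection onto the row
space of `F`. -/
theorem exists_isHermitian_conjTranspose_mul [Fintype ι] (F : Matrix ι κ ℂ) :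
    ∃ T : Matrix ι κ ℂ, (Fᴴ * T).IsHermitian ∧ F * (Fᴴ * T) = F := by
  classical
  have hG : IsSelfAdjoint (Fᴴ * F) := (isHermitian_conjTranspose_mul_self F).isSelfAdjoint
  have hcont (g : ℝ → ℝ) : ContinuousOn g (spectrum ℝ (Fᴴ * F)) :=
    (finite_real_spectrum).continuousOn g
  have hT : Fᴴ * (F * cfc (fun x : ℝ => x⁻¹) (Fᴴ * F)) = cfc (fun x : ℝ => x * x⁻¹) (Fᴴ * F) := by
    rw [← Matrix.mul_assoc, cfc_mul _ _ _ (hcont _) (hcont _), cfc_id' ℝ _ hG]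
  have hG_mul : Fᴴ * F * cfc (fun x : ℝ => x * x⁻¹) (Fᴴ * F) = Fᴴ * F := by
    nth_rw 1 [← cfc_id' ℝ (Fᴴ * F) hG]
    rw [← cfc_mul _ _ _ (hcont _) (hcont _)]
    simp_rw [← mul_assoc, mul_self_mul_inv]
    exact cfc_id' ℝ (Fᴴ * F) hG
  refine ⟨F * cfc (fun x : ℝ => x⁻¹) (Fᴴ * F), ?_, ?_⟩
  · rw [hT]
    exact cfc_predicate _ _
  · rw [hT, ← sub_eq_zero, ← conjTranspose_mul_self_eq_zero]
    have hzero : Fᴴ * (F * cfc (fun x : ℝ => x * x⁻¹) (Fᴴ * F) - F) = 0 := by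
      rw [Matrix.mul_sub, ← Matrix.mul_assoc, hG_mul, sub_self]
    rw [conjTranspose_sub, conjTranspose_mul, Matrix.sub_mul, Matrix.mul_assoc, hzero,
      Matrix.mul_zero, sub_zero]

theorem exists_skewHermitian_intertwining [Finite ι] {F N : Matrix ι κ ℂ}
    (h : F * Nᴴ + N * Fᴴ = 0) :
    ∃ P K : Matrix κ κ ℂ, IsStarProjection P ∧ F * P = F ∧ Kᴴ = -K ∧ N * P = F * K := by
  cases nonempty_fintype ι
  obtain ⟨T, hT, hFT⟩ := exists_isHermitian_conjTranspose_mul F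
  have hTF : Tᴴ * F = Fᴴ * T := by simpa using hT.eq
  have hNF : N * Fᴴ = -(F * Nᴴ) := eq_neg_of_add_eq_zero_right h
  refine ⟨Fᴴ * T, -(Tᴴ * (F * Nᴴ) * T), ⟨?_, hT⟩, hFT, ?_, ?_⟩
  · calc Fᴴ * T * (Fᴴ * T) = Tᴴ * (F * (Fᴴ * T)) := by rw [← Matrix.mul_assoc Tᴴ, hTF]
      _ = Fᴴ * T := by rw [hFT, hTF]
  · calc (-(Tᴴ * (F * Nᴴ) * T))ᴴ = -(Tᴴ * (N * Fᴴ) * T) := by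
          simp only [conjTranspose_neg, conjTranspose_mul, conjTranspose_conjTranspose,
            Matrix.mul_assoc]
      _ = -(-(Tᴴ * (F * Nᴴ) * T)) := by rw [hNF, Matrix.mul_neg, Matrix.neg_mul]
  · calc N * (Fᴴ * T) = -(F * Nᴴ * T) := by rw [← Matrix.mul_assoc, hNF, Matrix.neg_mul]
      _ = -(F * (Tᴴ * F) * Nᴴ * T) := by rw [hTF, hFT]
      _ = F * -(Tᴴ * (F * Nᴴ) * T) := by simp only [Matrix.mul_neg, Matrix.mul_assoc]

variable [DecidableEq κ]

theorem exists_unitary_mulVec_col_eq_smul {K : Matrix κ κ ℂ} (hK : Kᴴ = -K) :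
    ∃ V : Matrix κ κ ℂ, V * Vᴴ = 1 ∧
      ∀ k, ∃ ω : ℝ, K *ᵥ V.col k = (Complex.I * ω) • V.col k := by
  have hH : (-Complex.I • K).IsHermitian := by
    simp [IsHermitian, conjTranspose_smul, hK]
  refine ⟨hH.eigenvectorUnitary, Unitary.coe_mul_star_self _, fun k => ⟨hH.eigenvalues k, ?_⟩⟩
  have hk : -Complex.I • K *ᵥ hH.eigenvectorBasis k
      = (hH.eigenvalues k : ℂ) • ⇑(hH.eigenvectorBasis k) := by
    rw [← smul_mulVec]
    exact hH.mulVec_eigenvectorBasis k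
  rw [hH.eigenvectorUnitary_col_eq, mul_smul, ← hk, smul_smul]
  simp

theorem exists_coisometry_cols_eq_smul [Finite ι] {F N : Matrix ι κ ℂ}
    (h : F * Nᴴ + N * Fᴴ = 0) :
    ∃ R : Matrix κ (κ ⊕ κ) ℂ, R * Rᴴ = 1 ∧ ∀ k, (F * R).col k = 0 ∨
      ∃ ω : ℝ, (N * R).col k = (Complex.I * ω) • (F * R).col k := by
  obtain ⟨P, K, hP, hFP, hK, hNP⟩ := exists_skewHermitian_intertwining h
  obtain ⟨V, hV, hKV⟩ := exists_unitary_mulVec_col_eq_smul hK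
  have hcols (Y : Matrix ι κ ℂ) : Y * fromCols (P * V) (1 - P)
      = fromCols (Y * P * V) (Y * (1 - P)) := by
    rw [mul_fromCols, Matrix.mul_assoc]
  refine ⟨fromCols (P * V) (1 - P), ?_, ?_⟩
  · calc fromCols (P * V) (1 - P) * (fromCols (P * V) (1 - P))ᴴ
        = P * (V * Vᴴ) * Pᴴ + (1 - P) * (1 - P)ᴴ := by
          simp only [conjTranspose_fromCols_eq_fromRows_conjTranspose, fromCols_mul_fromRows,
            conjTranspose_mul, Matrix.mul_assoc]
      _ = P * star P + (1 - P) * star (1 - P) := by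
          rw [hV, Matrix.mul_one, star_eq_conjTranspose, star_eq_conjTranspose]
      _ = 1 := by
          rw [hP.isSelfAdjoint, hP.isIdempotentElem, hP.one_sub.isSelfAdjoint,
            hP.one_sub.isIdempotentElem, add_sub_cancel]
  · rw [hcols, hcols, hFP, Matrix.mul_sub, hFP, Matrix.mul_one, sub_self, hNP]
    rintro (k | k)
    · obtain ⟨ω, hω⟩ := hKV k
      refine .inr ⟨ω, ?_⟩
      calc (F * K * V).col k = F *ᵥ (K *ᵥ V.col k) := mulVec_mulVec (V.col k) F K |>.symm
        _ = (Complex.I * ω) • F *ᵥ V.col k := by rw [hω, mulVec_smul]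
    · exact .inl rfl

end SkewProduct

section Spectrum

theorem tendsto_pow_zero_of_spectralRadius_lt_one {𝔸 : Type*} [NormedRing 𝔸] [NormedAlgebra ℂ 𝔸]
    [CompleteSpace 𝔸] {a : 𝔸} (ha : spectralRadius ℂ a < 1) :
    Filter.Tendsto (a ^ ·) Filter.atTop (𝓝 0) := by
  obtain ⟨r, har, hr⟩ := exists_between ha
  lift r to NNReal using (hr.trans_le le_top).ne
  refine squeeze_zero_norm' (a := fun k => (r : ℝ) ^ k) ?_
    (tendsto_pow_atTop_nhds_zero_of_lt_one r.2 (by exact_mod_cast hr))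
  have hroot := spectrum.pow_nnnorm_pow_one_div_tendsto_nhds_spectralRadius a
  filter_upwards [hroot.eventually_lt_const har, Filter.eventually_gt_atTop 0] with k hk hk0
  rw [one_div, ENNReal.rpow_inv_lt_iff (by positivity), ENNReal.rpow_natCast] at hk
  exact_mod_cast hk.le

variable {ι : Type*} [Fintype ι] [DecidableEq ι]

theorem mem_spectrum_iff_exists_mulVec_eq_smul {K : Type*} [Field K] {A : Matrix ι ι K} {s : K} :
    s ∈ spectrum K A ↔ ∃ v, v ≠ 0 ∧ A *ᵥ v = s • v := by
  rw [spectrum.mem_iff, Algebra.algebraMap_eq_smul_one, isUnit_iff_isUnit_det, isUnit_iff_ne_zero,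
    not_not, ← exists_mulVec_eq_zero_iff]
  simp only [sub_mulVec, smul_mulVec, one_mulVec, sub_eq_zero, eq_comm]

open scoped Matrix.Norms.L2Operator in
theorem tendsto_pow_zero_of_spectrum {B : Matrix ι ι ℂ} (hB : ∀ s ∈ spectrum ℂ B, ‖s‖ < 1) :
    Filter.Tendsto (B ^ ·) Filter.atTop (𝓝 0) := by
  rcases isEmpty_or_nonempty ι with hι | hι
  · exact tendsto_const_nhds.congr fun k => Subsingleton.elim _ _
  obtain ⟨s, hs, hs_eq⟩ := spectrum.exists_nnnorm_eq_spectralRadius B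
  refine tendsto_pow_zero_of_spectralRadius_lt_one ?_
  rw [← hs_eq]
  exact_mod_cast hB s hs

/- The form of `X` decreases strictly along the orbits of `B`, which tend to zero. -/
theorem posDef_of_stein {B X : Matrix ι ι ℂ} (hB : ∀ s ∈ spectrum ℂ B, ‖s‖ < 1)
    (hX : X.IsHermitian) (h : (X - Bᴴ * X * B).PosDef) : X.PosDef := by
  let q (v : ι → ℂ) : ℝ := (star v ⬝ᵥ X *ᵥ v).re
  have hq_sub (v : ι → ℂ) : (star v ⬝ᵥ (X - Bᴴ * X * B) *ᵥ v).re = q v - q (B *ᵥ v) := by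
    simp only [q, sub_mulVec, dotProduct_sub, Complex.sub_re, star_mulVec, dotProduct_mulVec,
      vecMul_vecMul, Matrix.mul_assoc]
  have hanti (v : ι → ℂ) : Antitone fun k : ℕ => q (B ^ k *ᵥ v) := by
    refine antitone_nat_of_succ_le fun k => ?_
    have := (posSemidef_iff_re_nonneg.mp h.posSemidef).2 (B ^ k *ᵥ v)
    rw [hq_sub, mulVec_mulVec, ← pow_succ'] at this
    exact sub_nonneg.mp this
  have hlim (v : ι → ℂ) : Filter.Tendsto (fun k : ℕ => q (B ^ k *ᵥ v)) Filter.atTop (𝓝 0) := by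
    have hcont : Continuous fun Z : Matrix ι ι ℂ => q (Z *ᵥ v) := by fun_prop
    simpa [q, Function.comp_def] using (hcont.tendsto 0).comp (tendsto_pow_zero_of_spectrum hB)
  refine posDef_iff_re_pos.mpr ⟨hX, fun v hv => ?_⟩
  have hstep := (posDef_iff_re_pos.mp h).2 v hv
  have hnonneg := (hanti v).le_of_tendsto (hlim v) 1
  rw [hq_sub] at hstep
  rw [pow_one] at hnonneg
  linarith

/-- The Cayley transform `(1 + A) (1 - A)⁻¹`, which carries the open left half plane to the open
unit disc and so a Lyapunov inequality to a Stein inequality. -/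
noncomputable def cayleyTransform (A : Matrix ι ι ℂ) : Matrix ι ι ℂ := (1 + A) * (1 - A)⁻¹

theorem isUnit_one_sub_of_spectrum_re_neg {A : Matrix ι ι ℂ} (hA : ∀ s ∈ spectrum ℂ A, s.re < 0) :
    IsUnit (1 - A) := by
  have h1 : (1 : ℂ) ∉ spectrum ℂ A := fun h => by simpa using (hA 1 h).trans one_pos
  simpa [Algebra.algebraMap_eq_smul_one] using spectrum.notMem_iff.mp h1

theorem exists_eq_div_of_mem_spectrum_cayleyTransform {A : Matrix ι ι ℂ} (hA : IsUnit (1 - A))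
    {s : ℂ} (hs : s ∈ spectrum ℂ (cayleyTransform A)) :
    ∃ z ∈ spectrum ℂ A, z = (s - 1) / (s + 1) ∧ s + 1 ≠ 0 := by
  have hdet := (isUnit_iff_isUnit_det _).mp hA
  obtain ⟨v, hv, hsv⟩ := mem_spectrum_iff_exists_mulVec_eq_smul.mp hs
  obtain ⟨w, rfl⟩ : ∃ w, v = (1 - A) *ᵥ w :=
    ⟨(1 - A)⁻¹ *ᵥ v, by rw [mulVec_mulVec, mul_nonsing_inv _ hdet, one_mulVec]⟩
  have hw : w ≠ 0 := by
    rintro rfl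
    exact hv (mulVec_zero _)
  have hAw : (s + 1) • A *ᵥ w = (s - 1) • w := by
    rw [mulVec_mulVec, cayleyTransform, Matrix.mul_assoc, nonsing_inv_mul _ hdet, Matrix.mul_one,
      add_mulVec, sub_mulVec, one_mulVec] at hsv
    rw [← sub_eq_zero] at hsv ⊢
    rw [← hsv]
    module
  have hs1 : s + 1 ≠ 0 := fun h0 => by
    rw [h0, zero_smul, eq_comm, smul_eq_zero, or_iff_left hw, eq_neg_of_add_eq_zero_left h0] at hAw
    norm_num at hAw
  refine ⟨_, mem_spectrum_iff_exists_mulVec_eq_smul.mpr ⟨w, hw, ?_⟩, rfl, hs1⟩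
  rw [div_eq_inv_mul, mul_smul, ← hAw, inv_smul_smul₀ hs1]

theorem norm_lt_one_of_mem_spectrum_cayleyTransform {A : Matrix ι ι ℂ}
    (hA : ∀ s ∈ spectrum ℂ A, s.re < 0) {s : ℂ} (hs : s ∈ spectrum ℂ (cayleyTransform A)) :
    ‖s‖ < 1 := by
  obtain ⟨z, hz, rfl, hs1⟩ := exists_eq_div_of_mem_spectrum_cayleyTransform
    (isUnit_one_sub_of_spectrum_re_neg hA) hs
  have hlt := hA _ hz
  rw [Complex.div_re, ← add_div, div_lt_iff₀ (Complex.normSq_pos.mpr hs1), zero_mul] at hlt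
  simp only [Complex.sub_re, Complex.add_re, Complex.one_re, Complex.sub_im, Complex.add_im,
    Complex.one_im, sub_zero, add_zero] at hlt
  rw [← sq_lt_one_iff₀ (norm_nonneg s), Complex.sq_norm, Complex.normSq_apply]
  linarith

theorem posDef_of_lyapunov {A X : Matrix ι ι ℂ} (hA : ∀ s ∈ spectrum ℂ A, s.re < 0)
    (hX : X.IsHermitian) (h : (-(Aᴴ * X) - X * A).PosDef) : X.PosDef := by
  have hunit := isUnit_one_sub_of_spectrum_re_neg hA
  have hdet := (isUnit_iff_isUnit_det _).mp hunit
  refine posDef_of_stein (fun s => norm_lt_one_of_mem_spectrum_cayleyTransform hA) hX ?_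
  have hmul : cayleyTransform A * (1 - A) = 1 + A := nonsing_inv_mul_cancel_right _ _ hdet
  have hstein : star (1 - A) * (X - (cayleyTransform A)ᴴ * X * cayleyTransform A) * (1 - A)
      = (2 : ℝ) • (-(Aᴴ * X) - X * A) :=
    calc _ = (1 - A)ᴴ * X * (1 - A)
          - (cayleyTransform A * (1 - A))ᴴ * X * (cayleyTransform A * (1 - A)) := by
          rw [conjTranspose_mul, star_eq_conjTranspose]
          noncomm_ring
      _ = _ := by
          rw [hmul, conjTranspose_sub, conjTranspose_add, conjTranspose_one, ofNat_smul_eq_nsmul]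
          noncomm_ring
  rw [← hunit.posDef_star_left_conjugate_iff, hstein]
  exact h.smul two_pos

end Spectrum

section ChainRule

variable {F : Type*} [NormedAddCommGroup F] [NormedSpace ℝ F] {x g : ℝ → F} {a b : ℝ}

theorem absolutelyContinuousOnInterval_of_dist_le {α β : Type*} [PseudoMetricSpace α]
    [PseudoMetricSpace β] {f : ℝ → α} {h : ℝ → β} {K : ℝ}
    (hh : AbsolutelyContinuousOnInterval h a b)
    (hle : ∀ s ∈ Set.uIcc a b, ∀ t ∈ Set.uIcc a b, dist (f s) (f t) ≤ K * dist (h s) (h t)) :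
    AbsolutelyContinuousOnInterval f a b := by
  refine squeeze_zero' (.of_forall fun _ => Finset.sum_nonneg fun _ _ => dist_nonneg) ?_
    (by simpa only [mul_zero] using Filter.Tendsto.const_mul K hh)
  rw [Filter.eventually_inf_principal]
  filter_upwards with E hE
  rw [Finset.mul_sum]
  exact Finset.sum_le_sum fun i hi => hle _ (hE.1 i hi).1 _ (hE.1 i hi).2

theorem dist_primitive_le_dist_primitive_norm (hg : IntervalIntegrable g volume a b)
    {s t : ℝ} (hs : s ∈ Set.uIcc a b) (ht : t ∈ Set.uIcc a b) :
    dist (∫ r in a..s, g r) (∫ r in a..t, g r)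
      ≤ dist (∫ r in a..s, ‖g r‖) (∫ r in a..t, ‖g r‖) := by
  have hgs := hg.mono_set (Set.uIcc_subset_uIcc_left hs)
  have hgt := hg.mono_set (Set.uIcc_subset_uIcc_left ht)
  rw [dist_eq_norm, Real.dist_eq, intervalIntegral.integral_interval_sub_left hgs hgt,
    intervalIntegral.integral_interval_sub_left hgs.norm hgt.norm]
  exact intervalIntegral.norm_integral_le_abs_integral_norm

theorem absolutelyContinuousOnInterval_comp_of_eq_primitive {φ : F → ℝ} (hφ : LocallyLipschitz φ)
    (hg : IntervalIntegrable g volume a b) (hx : ∀ t, x t = x a + ∫ r in a..t, g r) :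
    AbsolutelyContinuousOnInterval (fun t => φ (x t)) a b := by
  have hx_cont : ContinuousOn x (Set.uIcc a b) := by
    rw [funext hx]
    exact continuousOn_const.add
      (intervalIntegral.continuousOn_primitive_interval' hg Set.left_mem_uIcc)
  obtain ⟨K, hK⟩ := hφ.locallyLipschitzOn.exists_lipschitzOnWith_of_compact
    (isCompact_uIcc.image_of_continuousOn hx_cont)
  have hnorm := hg.norm.absolutelyContinuousOnInterval_intervalIntegral Set.left_mem_uIcc
  refine absolutelyContinuousOnInterval_of_dist_le hnorm (K := K) fun s hs t ht => ?_
  calc dist (φ (x s)) (φ (x t)) ≤ K * dist (x s) (x t) :=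
        hK.dist_le_mul _ (Set.mem_image_of_mem x hs) _ (Set.mem_image_of_mem x ht)
    _ ≤ K * dist (∫ r in a..s, ‖g r‖) (∫ r in a..t, ‖g r‖) := by
        rw [hx s, hx t, dist_add_left]
        gcongr
        exact dist_primitive_le_dist_primitive_norm hg hs ht

theorem integral_fderiv_comp_of_eq_primitive [CompleteSpace F] {φ : F → ℝ} (hφ : ContDiff ℝ 1 φ)
    (hg : IntervalIntegrable g volume a b) (hx : ∀ t, x t = x a + ∫ r in a..t, g r) :
    ∫ t in a..b, fderiv ℝ φ (x t) (g t) = φ (x b) - φ (x a) := by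
  rw [← (absolutelyContinuousOnInterval_comp_of_eq_primitive
    hφ.locallyLipschitz hg hx).integral_deriv_eq_sub]
  refine intervalIntegral.integral_congr_ae ?_
  filter_upwards [hg.ae_hasDerivAt_integral] with t ht htab
  have hxt : HasDerivAt x (g t) t := by
    rw [funext hx]
    exact (ht (Set.uIoc_subset_uIcc htab) a Set.left_mem_uIcc).const_add _
  exact ((hφ.differentiable one_ne_zero (x t)).hasFDerivAt.comp_hasDerivAt t hxt).deriv.symm

end ChainRule

section SquareIntegrable

variable {ι κ α 𝕜 : Type*} [Fintype ι] [Fintype κ] [RCLike 𝕜] [MeasurableSpace α] {μ : Measure α}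

theorem integrable_star_dotProduct {f g : α → ι → 𝕜} (hf : MemLp f 2 μ)
    (hg : MemLp g 2 μ) : Integrable (fun a => star (f a) ⬝ᵥ g a) μ :=
  integrable_finsetSum _ fun i _ => (hf.eval i).star.integrable_mul (hg.eval i)

theorem memLp_mulVec {p : ENNReal} {f : α → ι → 𝕜}
    (hf : MemLp f p μ) (Q : Matrix κ ι 𝕜) : MemLp (fun a => Q *ᵥ f a) p μ :=
  hf.continuousLinearMap_comp Q.mulVecLin.toContinuousLinearMap

end SquareIntegrable

section Sesquilinear

variable {ι κ : Type*} [Fintype ι] [Fintype κ]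

theorem star_dotProduct_conjTranspose_mulVec (R : Matrix κ ι ℂ) (v : ι → ℂ) (w : κ → ℂ) :
    star v ⬝ᵥ Rᴴ *ᵥ w = star (R *ᵥ v) ⬝ᵥ w := by
  rw [dotProduct_mulVec, ← star_mulVec]

theorem re_star_dotProduct_comm (v w : ι → ℂ) : (star v ⬝ᵥ w).re = (star w ⬝ᵥ v).re := by
  rw [star_dotProduct, Complex.star_def, Complex.conj_re]

theorem re_star_dotProduct_mulVec_comm {X : Matrix ι ι ℂ} (hX : X.IsHermitian) (v w : ι → ℂ) :
    (star v ⬝ᵥ X *ᵥ w).re = (star w ⬝ᵥ X *ᵥ v).re := by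
  rw [re_star_dotProduct_comm, ← star_dotProduct_conjTranspose_mulVec, hX.eq]

theorem re_star_dotProduct_mulVec_I_smul {X : Matrix ι ι ℂ} (hX : X.IsHermitian) (v : ι → ℂ)
    (ω : ℝ) : (star v ⬝ᵥ X *ᵥ ((Complex.I * ω) • v)).re = 0 := by
  have him : (star v ⬝ᵥ X *ᵥ v).im = 0 := hX.im_star_dotProduct_mulVec_self v
  simp [mulVec_smul, dotProduct_smul, him]

theorem re_star_dotProduct_conjTranspose_add_mulVec (T : Matrix ι ι ℂ) (v : ι → ℂ) :
    (star v ⬝ᵥ (Tᴴ + T) *ᵥ v).re = 2 * (star (T *ᵥ v) ⬝ᵥ v).re := by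
  rw [add_mulVec, dotProduct_add, Complex.add_re, star_dotProduct_conjTranspose_mulVec,
    re_star_dotProduct_comm v, two_mul]

theorem mulVec_eq_zero_of_re_star_dotProduct_eq_zero {P : Matrix ι ι ℂ} (hP : P.PosSemidef)
    {v : ι → ℂ} (h : (star v ⬝ᵥ P *ᵥ v).re = 0) : P *ᵥ v = 0 :=
  (hP.dotProduct_mulVec_zero_iff v).mp (Complex.ext h (hP.1.im_star_dotProduct_mulVec_self v))

end Sesquilinear

namespace LTISystem

variable {n m : ℕ} (M : LTISystem n m)

/-- The linear part of the affine map `X ↦ W(X, M)`. -/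
noncomputable def linW :
    Matrix (Fin n) (Fin n) ℂ →ₗ[ℝ] Matrix (Fin n ⊕ Fin m) (Fin n ⊕ Fin m) ℂ where
  toFun X := fromBlocks (-(M.Aᴴ * X) - X * M.A) (-(X * M.B)) (-(M.Bᴴ * X)) 0
  map_add' X Y := by
    rw [fromBlocks_add, Matrix.mul_add, Matrix.mul_add, Matrix.add_mul, Matrix.add_mul]
    congr 1 <;> abel
  map_smul' c X := by
    simp only [fromBlocks_smul, Matrix.mul_smul, Matrix.smul_mul, smul_sub, smul_neg, smul_zero,
      RingHom.id_apply]

theorem W_eq_add_linW (X : Matrix (Fin n) (Fin n) ℂ) : M.W X = M.W 0 + M.linW X := by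
  simp only [W, linW, LinearMap.coe_mk, AddHom.coe_mk, fromBlocks_add, Matrix.mul_zero,
    Matrix.zero_mul]
  congr 1 <;> abel

theorem isHermitian_W {X : Matrix (Fin n) (Fin n) ℂ} (hX : X.IsHermitian) :
    (M.W X).IsHermitian := by
  rw [W, isHermitian_fromBlocks_iff]
  refine ⟨?_, ?_, ?_, ?_⟩ <;>
    simp only [IsHermitian, conjTranspose_sub, conjTranspose_add, conjTranspose_neg,
      conjTranspose_mul, conjTranspose_conjTranspose, hX.eq] <;> abel

theorem isHermitian_linW {X : Matrix (Fin n) (Fin n) ℂ} (hX : X.IsHermitian) :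
    (M.linW X).IsHermitian := by
  rw [eq_sub_of_add_eq' (M.W_eq_add_linW X).symm]
  exact (M.isHermitian_W hX).sub (M.isHermitian_W isHermitian_zero)

/- Along a trajectory this is twice the supply rate minus twice the growth rate of `½ xᴴ X x`. -/
theorem re_star_dotProduct_W_mulVec {X : Matrix (Fin n) (Fin n) ℂ} (hX : X.IsHermitian)
    (f : Fin n → ℂ) (g : Fin m → ℂ) :
    (star (Sum.elim f g) ⬝ᵥ M.W X *ᵥ Sum.elim f g).re
      = 2 * (star (M.C *ᵥ f + M.D *ᵥ g) ⬝ᵥ g).re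
        - 2 * (star f ⬝ᵥ X *ᵥ (M.A *ᵥ f + M.B *ᵥ g)).re := by
  have hstar : star (Sum.elim f g) = Sum.elim (star f) (star g) := by
    ext i
    cases i <;> rfl
  rw [hstar, W, fromBlocks_mulVec]
  simp only [Sum.elim_comp_inl, Sum.elim_comp_inr, sumElim_dotProduct_sumElim, sub_mulVec,
    add_mulVec, neg_mulVec, ← mulVec_mulVec, dotProduct_add, dotProduct_sub, dotProduct_neg,
    star_dotProduct_conjTranspose_mulVec, star_add, add_dotProduct, mulVec_add, Complex.add_re,
    Complex.sub_re, Complex.neg_re]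
  linarith [re_star_dotProduct_mulVec_comm hX (M.A *ᵥ f) f,
    re_star_dotProduct_mulVec_comm hX (M.B *ᵥ g) f, re_star_dotProduct_comm (M.C *ᵥ f) g,
    re_star_dotProduct_comm (M.D *ᵥ g) g]

theorem re_star_dotProduct_linW_mulVec {X : Matrix (Fin n) (Fin n) ℂ} (hX : X.IsHermitian)
    (f : Fin n → ℂ) (g : Fin m → ℂ) :
    (star (Sum.elim f g) ⬝ᵥ M.linW X *ᵥ Sum.elim f g).re
      = -2 * (star f ⬝ᵥ X *ᵥ (M.A *ᵥ f + M.B *ᵥ g)).re := by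
  rw [eq_sub_of_add_eq' (M.W_eq_add_linW X).symm, sub_mulVec, dotProduct_sub, Complex.sub_re,
    M.re_star_dotProduct_W_mulVec hX, M.re_star_dotProduct_W_mulVec isHermitian_zero, zero_mulVec,
    dotProduct_zero, Complex.zero_re]
  ring

theorem re_star_dotProduct_W_mulVec_zero_left {X : Matrix (Fin n) (Fin n) ℂ}
    (hX : X.IsHermitian) (g : Fin m → ℂ) :
    (star (Sum.elim 0 g) ⬝ᵥ M.W X *ᵥ Sum.elim 0 g).re = (star g ⬝ᵥ (M.Dᴴ + M.D) *ᵥ g).re := by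
  simp only [M.re_star_dotProduct_W_mulVec hX, mulVec_zero, zero_add, star_zero, zero_dotProduct,
    Complex.zero_re, mul_zero, sub_zero, re_star_dotProduct_conjTranspose_add_mulVec]

variable {M}

section FrequencyDomain

variable {f : Fin n → ℂ} {g : Fin m → ℂ}

theorem state_eq_iff_eq_inv_mulVec {s : ℂ} (hs : s ∉ spectrum ℂ M.A) :
    M.A *ᵥ f + M.B *ᵥ g = s • f ↔ f = (s • 1 - M.A)⁻¹ *ᵥ (M.B *ᵥ g) := by
  have hunit : IsUnit (s • 1 - M.A) := by
    simpa only [Algebra.algebraMap_eq_smul_one] using spectrum.notMem_iff.mp hs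
  have hdet := (isUnit_iff_isUnit_det _).mp hunit
  have hresolvent : M.A *ᵥ f + M.B *ᵥ g = s • f ↔ (s • 1 - M.A) *ᵥ f = M.B *ᵥ g := by
    rw [sub_mulVec, smul_mulVec, one_mulVec, sub_eq_iff_eq_add', eq_comm]
  rw [hresolvent]
  constructor
  · intro h
    rw [← h, mulVec_mulVec, nonsing_inv_mul _ hdet, one_mulVec]
  · rintro rfl
    rw [mulVec_mulVec, mul_nonsing_inv _ hdet, one_mulVec]

theorem transfer_mulVec (s : ℂ) :
    M.transfer s *ᵥ g = M.C *ᵥ ((s • 1 - M.A)⁻¹ *ᵥ (M.B *ᵥ g)) + M.D *ᵥ g := by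
  simp only [transfer, add_mulVec, mulVec_mulVec, Matrix.mul_assoc]

theorem IsAsymptoticallyStable.I_mul_notMem_spectrum (hA : M.IsAsymptoticallyStable) (ω : ℝ) :
    Complex.I * ω ∉ spectrum ℂ M.A := fun h => by
  simpa using hA _ h

/- On harmonic trajectories the storage does not change on average, so only the supply remains. -/
theorem re_star_dotProduct_W_mulVec_eq_popov {X : Matrix (Fin n) (Fin n) ℂ} (hX : X.IsHermitian)
    {ω : ℝ} (hω : Complex.I * ω ∉ spectrum ℂ M.A)
    (h : M.A *ᵥ f + M.B *ᵥ g = (Complex.I * ω) • f) :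
    (star (Sum.elim f g) ⬝ᵥ M.W X *ᵥ Sum.elim f g).re = (star g ⬝ᵥ M.popov ω *ᵥ g).re := by
  have hf := (state_eq_iff_eq_inv_mulVec hω).mp h
  rw [M.re_star_dotProduct_W_mulVec hX, h, re_star_dotProduct_mulVec_I_smul hX, popov,
    re_star_dotProduct_conjTranspose_add_mulVec, transfer_mulVec, ← hf, mul_zero, sub_zero]

end FrequencyDomain

section KalmanYakubovichPopov

variable {X : Matrix (Fin n) (Fin n) ℂ}

theorem isAsymptoticallyStable_of_mem_strictSolSet (h : X ∈ M.strictSolSet) :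
    M.IsAsymptoticallyStable := by
  intro s hs
  obtain ⟨v, hv, hAv⟩ := mem_spectrum_iff_exists_mulVec_eq_smul.mp hs
  have hW := (posDef_iff_re_pos.mp h.2).2 (Sum.elim v 0)
    fun h0 => hv (funext fun i => congrFun h0 (Sum.inl i))
  have hXv := (posDef_iff_re_pos.mp h.1).2 v hv
  have him : (star v ⬝ᵥ X *ᵥ v).im = 0 := h.1.1.im_star_dotProduct_mulVec_self v
  rw [M.re_star_dotProduct_W_mulVec h.1.1] at hW
  simp only [mulVec_zero, add_zero, dotProduct_zero, Complex.zero_re, hAv, mulVec_smul,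
    dotProduct_smul, smul_eq_mul, Complex.mul_re, him, mul_zero, sub_zero, zero_sub] at hW
  nlinarith

theorem isStrictlyPassive_of_mem_strictSolSet (h : X ∈ M.strictSolSet) : M.IsStrictlyPassive := by
  have hA := isAsymptoticallyStable_of_mem_strictSolSet h
  have hW := (posDef_iff_re_pos.mp h.2).2
  have hne (f : Fin n → ℂ) {g : Fin m → ℂ} (hg : g ≠ 0) : Sum.elim f g ≠ 0 :=
    fun h0 => hg (funext fun i => congrFun h0 (Sum.inr i))
  refine ⟨hA, fun ω => posDef_iff_re_pos.mpr ⟨isHermitian_transpose_add_self _, fun g hg => ?_⟩,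
    posDef_iff_re_pos.mpr ⟨isHermitian_transpose_add_self _, fun g hg => ?_⟩⟩
  · have hω := hA.I_mul_notMem_spectrum ω
    rw [← re_star_dotProduct_W_mulVec_eq_popov h.1.1 hω
      ((state_eq_iff_eq_inv_mulVec hω).mpr rfl)]
    exact hW _ (hne _ hg)
  · rw [← M.re_star_dotProduct_W_mulVec_zero_left h.1.1]
    exact hW _ (hne 0 hg)

theorem IsStrictlyPassive.re_star_dotProduct_W_zero_pos (hM : M.IsStrictlyPassive)
    {f : Fin n → ℂ} {g : Fin m → ℂ} (hfg : Sum.elim f g ≠ 0)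
    (h : f = 0 ∨ ∃ ω : ℝ, M.A *ᵥ f + M.B *ᵥ g = (Complex.I * ω) • f) :
    0 < (star (Sum.elim f g) ⬝ᵥ M.W 0 *ᵥ Sum.elim f g).re := by
  have hg : g ≠ 0 := by
    rintro rfl
    refine hfg (Sum.elim_eq_iff.mpr ⟨?_, rfl⟩ |>.trans Sum.elim_zero_zero)
    rcases h with hf | ⟨ω, h⟩
    · exact hf
    · rw [(state_eq_iff_eq_inv_mulVec (hM.1.I_mul_notMem_spectrum ω)).mp h, mulVec_zero,
        mulVec_zero]
  rcases h with rfl | ⟨ω, h⟩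
  · rw [M.re_star_dotProduct_W_mulVec_zero_left isHermitian_zero]
    exact (posDef_iff_re_pos.mp hM.2.2).2 g hg
  · rw [re_star_dotProduct_W_mulVec_eq_popov isHermitian_zero (hM.1.I_mul_notMem_spectrum ω) h]
    exact (posDef_iff_re_pos.mp (hM.2.1 ω)).2 g hg

theorem re_trace_linW_mul_mul_conjTranspose {κ : Type*} [Fintype κ] (hX : X.IsHermitian)
    (S : Matrix (Fin n ⊕ Fin m) κ ℂ) :
    (M.linW X * (S * Sᴴ)).trace.re
      = -2 * (X * ((M.A * S.toRows₁ + M.B * S.toRows₂) * S.toRows₁ᴴ)).trace.re := by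
  rw [trace_mul_mul_conjTranspose, trace_mul_mul_conjTranspose, Complex.re_sum, Complex.re_sum,
    Finset.mul_sum]
  refine Finset.sum_congr rfl fun k _ => ?_
  have hcol : S.col k = Sum.elim (S.toRows₁.col k) (S.toRows₂.col k) := by
    ext i
    cases i <;> rfl
  rw [hcol, M.re_star_dotProduct_linW_mulVec hX]
  rfl

theorem toRows_mul_conjTranspose_skew {κ : Type*} [Fintype κ]
    {S : Matrix (Fin n ⊕ Fin m) κ ℂ}
    (h : ∀ X : Matrix (Fin n) (Fin n) ℂ, X.IsHermitian → (M.linW X * (S * Sᴴ)).trace.re = 0) :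
    S.toRows₁ * (M.A * S.toRows₁ + M.B * S.toRows₂)ᴴ
      + (M.A * S.toRows₁ + M.B * S.toRows₂) * S.toRows₁ᴴ = 0 := by
  have hL := add_conjTranspose_eq_zero_of_re_trace_eq_zero
    (L := (M.A * S.toRows₁ + M.B * S.toRows₂) * S.toRows₁ᴴ) fun X hX => by
      have := M.re_trace_linW_mul_mul_conjTranspose hX S
      rw [h X hX] at this
      linarith
  rwa [conjTranspose_mul, conjTranspose_conjTranspose, add_comm] at hL

theorem IsStrictlyPassive.re_trace_W_zero_mul_pos (hM : M.IsStrictlyPassive)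
    {Z : Matrix (Fin n ⊕ Fin m) (Fin n ⊕ Fin m) ℂ} (hZ : Z.PosSemidef) (hZ0 : Z ≠ 0)
    (h : ∀ X : Matrix (Fin n) (Fin n) ℂ, X.IsHermitian → (M.linW X * Z).trace.re = 0) :
    0 < (M.W 0 * Z).trace.re := by
  obtain ⟨S, rfl⟩ := exists_eq_mul_conjTranspose hZ
  obtain ⟨R, hR, hcol⟩ := exists_coisometry_cols_eq_smul (toRows_mul_conjTranspose_skew h)
  have hSR : S * Sᴴ = S * R * (S * R)ᴴ := by
    rw [conjTranspose_mul, Matrix.mul_assoc, ← Matrix.mul_assoc R, hR, Matrix.one_mul]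
  have hpos (k) (hk : (S * R).col k ≠ 0) :
      0 < (star ((S * R).col k) ⬝ᵥ M.W 0 *ᵥ (S * R).col k).re := by
    have hsplit : (S * R).col k
        = Sum.elim ((S.toRows₁ * R).col k) ((S.toRows₂ * R).col k) := by
      ext i
      cases i <;> rfl
    rw [hsplit] at hk ⊢
    refine hM.re_star_dotProduct_W_zero_pos hk ((hcol k).imp_right fun ⟨ω, hω⟩ => ⟨ω, ?_⟩)
    rw [← hω, Matrix.add_mul, Matrix.mul_assoc, Matrix.mul_assoc]
    rfl
  obtain ⟨k, hk⟩ : ∃ k, (S * R).col k ≠ 0 := by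
    by_contra! hzero
    have hSR0 : S * R = 0 := Matrix.ext fun i k => congrFun (hzero k) i
    exact hZ0 (by rw [hSR, hSR0, Matrix.zero_mul])
  rw [hSR, trace_mul_mul_conjTranspose, Complex.re_sum]
  refine Finset.sum_pos' (fun j _ => ?_) ⟨k, Finset.mem_univ k, hpos k hk⟩
  rcases eq_or_ne ((S * R).col j) 0 with hj | hj
  · simp only [hj, star_zero, zero_dotProduct, Complex.zero_re, le_refl]
  · exact (hpos j hj).le

theorem IsStrictlyPassive.exists_isHermitian_posDef_W (hM : M.IsStrictlyPassive) :
    ∃ X : Matrix (Fin n) (Fin n) ℂ, X.IsHermitian ∧ (M.W X).PosDef := by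
  obtain ⟨X, hX⟩ := exists_add_posDef (M.isHermitian_W isHermitian_zero)
    (𝓛 := M.linW ∘ₗ (selfAdjoint.submodule ℝ (Matrix (Fin n) (Fin n) ℂ)).subtype)
    (fun X => M.isHermitian_linW X.2) fun Z hZ hpair =>
      hM.re_trace_W_zero_mul_pos hZ.1 (ne_zero_of_mem_spectraplex hZ) fun X hX => hpair ⟨X, hX⟩
  exact ⟨X, X.2, by rw [W_eq_add_linW]; exact hX⟩

theorem posDef_of_posDef_W (hA : M.IsAsymptoticallyStable) (hX : X.IsHermitian)
    (hW : (M.W X).PosDef) : X.PosDef :=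
  posDef_of_lyapunov hA hX (hW.submatrix Sum.inl_injective)

theorem isStrictlyPassive_iff_strictSolSet_nonempty :
    M.IsStrictlyPassive ↔ M.strictSolSet.Nonempty := by
  refine ⟨fun hM => ?_, fun ⟨X, hX⟩ => isStrictlyPassive_of_mem_strictSolSet hX⟩
  obtain ⟨X, hX, hW⟩ := hM.exists_isHermitian_posDef_W
  exact ⟨X, posDef_of_posDef_W hM.1 hX hW, hW⟩

end KalmanYakubovichPopov

end LTISystem

section BlockDiagonal

variable {ι κ : Type*} {P : Matrix ι ι ℂ} {Q : Matrix κ κ ℂ}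

theorem isHermitian_fromBlocks_zero_zero (hP : P.IsHermitian) (hQ : Q.IsHermitian) :
    (fromBlocks P 0 0 Q).IsHermitian :=
  hP.fromBlocks conjTranspose_zero hQ

theorem re_star_dotProduct_fromBlocks_zero_zero_mulVec [Fintype ι] [Fintype κ]
    (P : Matrix ι ι ℂ) (Q : Matrix κ κ ℂ) (v : ι ⊕ κ → ℂ) :
    (star v ⬝ᵥ fromBlocks P 0 0 Q *ᵥ v).re
      = (star (v ∘ Sum.inl) ⬝ᵥ P *ᵥ (v ∘ Sum.inl)).re
        + (star (v ∘ Sum.inr) ⬝ᵥ Q *ᵥ (v ∘ Sum.inr)).re := by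
  simp only [fromBlocks_mulVec, zero_mulVec, add_zero, zero_add, dotProduct, Fintype.sum_sum_type,
    Sum.elim_inl, Sum.elim_inr, Complex.add_re, Pi.star_apply, Function.comp_apply]

theorem posSemidef_fromBlocks_zero_zero [Finite ι] [Finite κ] (hP : P.PosSemidef)
    (hQ : Q.PosSemidef) : (fromBlocks P 0 0 Q).PosSemidef := by
  cases nonempty_fintype ι
  cases nonempty_fintype κ
  rw [posSemidef_iff_re_nonneg] at hP hQ ⊢
  refine ⟨isHermitian_fromBlocks_zero_zero hP.1 hQ.1, fun v => ?_⟩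
  rw [re_star_dotProduct_fromBlocks_zero_zero_mulVec]
  exact add_nonneg (hP.2 _) (hQ.2 _)

theorem posDef_fromBlocks_zero_zero [Finite ι] [Finite κ] (hP : P.PosDef) (hQ : Q.PosDef) :
    (fromBlocks P 0 0 Q).PosDef := by
  cases nonempty_fintype ι
  cases nonempty_fintype κ
  classical
  rw [(posSemidef_fromBlocks_zero_zero hP.posSemidef hQ.posSemidef).posDef_iff_isUnit,
    isUnit_fromBlocks_zero₂₁]
  exact ⟨hP.isUnit, hQ.isUnit⟩

end BlockDiagonal

section Controllability

variable {n m : ℕ} {A : Matrix (Fin n) (Fin n) ℂ}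

theorem IsControllablePair.exists_smul_sub_mulVec_add_mulVec_eq {B : Matrix (Fin n) (Fin m) ℂ}
    (h : IsControllablePair A B) (s : ℂ) (v : Fin n → ℂ) :
    ∃ a b, s • a - A *ᵥ a + B *ᵥ b = v := by
  have hrange : (fromCols (s • 1 - A) B).mulVecLin.range = ⊤ :=
    Submodule.eq_top_of_finrank_eq (by rw [Module.finrank_fin_fun]; exact h s)
  obtain ⟨w, rfl⟩ := LinearMap.range_eq_top.mp hrange v
  refine ⟨w ∘ Sum.inl, w ∘ Sum.inr, ?_⟩
  rw [mulVecLin_apply, fromCols_mulVec, sub_mulVec, smul_mulVec, one_mulVec]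

theorem IsControllablePair.eq_top_of_invariant {B : Matrix (Fin n) (Fin m) ℂ}
    (h : IsControllablePair A B) {U : Submodule ℂ (Fin n → ℂ)} (hA : ∀ v ∈ U, A *ᵥ v ∈ U)
    (hB : ∀ g, B *ᵥ g ∈ U) : U = ⊤ := by
  by_contra hU
  have : Nontrivial ((Fin n → ℂ) ⧸ U) := Submodule.Quotient.nontrivial_iff.mpr hU
  set T : Module.End ℂ ((Fin n → ℂ) ⧸ U) := U.mapQ U A.mulVecLin hA
  obtain ⟨s, hs⟩ := Module.End.exists_eigenvalue T
  obtain ⟨q, hq⟩ := hs.exists_hasEigenvector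
  have hsurj : Function.Surjective (s • (1 : Module.End ℂ ((Fin n → ℂ) ⧸ U)) - T) := by
    intro r
    obtain ⟨v, rfl⟩ := U.mkQ_surjective r
    obtain ⟨a, b, rfl⟩ := h.exists_smul_sub_mulVec_add_mulVec_eq s v
    refine ⟨U.mkQ a, ?_⟩
    have hb : U.mkQ (B *ᵥ b) = 0 := (Submodule.Quotient.mk_eq_zero U).mpr (hB b)
    rw [map_add, hb, add_zero]
    rfl
  refine hq.2 (LinearMap.injective_iff_surjective.mpr hsurj ?_)
  rw [map_zero, LinearMap.sub_apply, hq.apply_eq_smul, LinearMap.smul_apply,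
    Module.End.one_apply, sub_self]

theorem IsControllablePair.eq_bot_of_invariant {C : Matrix (Fin m) (Fin n) ℂ}
    (h : IsControllablePair Aᴴ Cᴴ) {U : Submodule ℂ (Fin n → ℂ)} (hA : ∀ v ∈ U, A *ᵥ v ∈ U)
    (hC : ∀ v ∈ U, C *ᵥ v = 0) : U = ⊥ := by
  let V : Submodule ℂ (Fin n → ℂ) := ⨅ v ∈ U, LinearMap.ker (dotProductBilin ℂ ℂ (star v))
  have hV (w) : w ∈ V ↔ ∀ v ∈ U, star v ⬝ᵥ w = 0 := by
    simp only [V, Submodule.mem_iInf, LinearMap.mem_ker, dotProductBilin_apply_apply]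
  have hVtop : V = ⊤ := by
    refine h.eq_top_of_invariant (fun w hw => (hV _).mpr fun v hv => ?_)
      fun g => (hV _).mpr fun v hv => ?_
    · rw [star_dotProduct_conjTranspose_mulVec]
      exact (hV w).mp hw _ (hA v hv)
    · rw [star_dotProduct_conjTranspose_mulVec, hC v hv, star_zero, zero_dotProduct]
  refine U.eq_bot_iff.mpr fun v hv => dotProduct_star_self_eq_zero.mp ?_
  exact (hV v).mp (hVtop ▸ Submodule.mem_top) v hv

theorem IsControllablePair.add_smul_one {B : Matrix (Fin n) (Fin m) ℂ}
    (h : IsControllablePair A B) (c : ℂ) : IsControllablePair (A + c • 1) B := fun s => by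
  rw [add_comm A, ← sub_sub, ← sub_smul]
  exact h (s - c)

end Controllability

section StoredEnergy

variable {ι : Type*} [Fintype ι]

/-- The real bilinear form `(v, w) ↦ Re (vᴴ X w)`. -/
noncomputable def reBilinForm (X : Matrix ι ι ℂ) : (ι → ℂ) →L[ℝ] (ι → ℂ) →L[ℝ] ℝ :=
  (LinearMap.mk₂ ℝ (fun v w => (star v ⬝ᵥ X *ᵥ w).re)
    (fun v v' w => by rw [star_add, add_dotProduct, Complex.add_re])
    (fun c v w => by rw [star_smul, star_trivial, smul_dotProduct, Complex.smul_re])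
    (fun v w w' => by rw [mulVec_add, dotProduct_add, Complex.add_re])
    (fun c v w => by rw [mulVec_smul, dotProduct_smul, Complex.smul_re])).toContinuousBilinearMap

theorem reBilinForm_apply (X : Matrix ι ι ℂ) (v w : ι → ℂ) :
    reBilinForm X v w = (star v ⬝ᵥ X *ᵥ w).re :=
  rfl

/-- The stored energy `½ zᴴ X z`, the storage function witnessing passivity. -/
noncomputable def storedEnergy (X : Matrix ι ι ℂ) (z : ι → ℂ) : ℝ :=
  2⁻¹ * reBilinForm X z z

theorem contDiff_storedEnergy (X : Matrix ι ι ℂ) : ContDiff ℝ 1 (storedEnergy X) :=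
  contDiff_const.mul (((reBilinForm X).contDiff).clm_apply contDiff_id)

theorem fderiv_storedEnergy {X : Matrix ι ι ℂ} (hX : X.IsHermitian) (z h : ι → ℂ) :
    fderiv ℝ (storedEnergy X) z h = (star z ⬝ᵥ X *ᵥ h).re := by
  have hform : HasFDerivAt (storedEnergy X)
      ((2⁻¹ : ℝ) • ((reBilinForm X z).comp (.id ℝ _) + (reBilinForm X).flip z)) z :=
    ((reBilinForm X).hasFDerivAt.clm_apply (hasFDerivAt_id z)).const_mul 2⁻¹
  rw [hform.fderiv]
  simp only [ContinuousLinearMap.comp_id, _root_.smul_apply, _root_.add_apply,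
    ContinuousLinearMap.flip_apply, reBilinForm_apply, smul_eq_mul,
    re_star_dotProduct_mulVec_comm hX h z]
  ring

end StoredEnergy

namespace LTISystem

variable {n m : ℕ} {M : LTISystem n m}

section Passivity

variable {x : ℝ → Fin n → ℂ} {u : ℝ → Fin m → ℂ} {a b : ℝ}

theorem IsTrajectory.memLp_state (h : M.IsTrajectory x u) (a b : ℝ) :
    MemLp x 2 (volume.restrict (Set.Icc a b)) := by
  obtain ⟨C, hC⟩ := (isCompact_Icc (a := a) (b := b)).exists_bound_of_continuousOn
    h.continuous_state.continuousOn
  exact MemLp.of_bound h.continuous_state.aestronglyMeasurable C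
    (ae_restrict_of_forall_mem measurableSet_Icc hC)

theorem IsTrajectory.memLp_stateDeriv (h : M.IsTrajectory x u) (a b : ℝ) :
    MemLp (fun t => M.A *ᵥ x t + M.B *ᵥ u t) 2 (volume.restrict (Set.Icc a b)) :=
  (memLp_mulVec (h.memLp_state a b) M.A).add (memLp_mulVec (h.memLp_input a b) M.B)

theorem IsTrajectory.memLp_output (h : M.IsTrajectory x u) (a b : ℝ) :
    MemLp (M.output x u) 2 (volume.restrict (Set.Icc a b)) :=
  (memLp_mulVec (h.memLp_state a b) M.C).add (memLp_mulVec (h.memLp_input a b) M.D)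

theorem IsTrajectory.intervalIntegrable_stateDeriv (h : M.IsTrajectory x u) (hab : a ≤ b) :
    IntervalIntegrable (fun t => M.A *ᵥ x t + M.B *ᵥ u t) volume a b :=
  (intervalIntegrable_iff_integrableOn_Icc_of_le hab).mpr
    ((h.memLp_stateDeriv a b).integrable one_le_two)

theorem IsTrajectory.intervalIntegrable_supply (h : M.IsTrajectory x u) (hab : a ≤ b) :
    IntervalIntegrable (fun t => (star (M.output x u t) ⬝ᵥ u t).re) volume a b :=
  (intervalIntegrable_iff_integrableOn_Icc_of_le hab).mpr
    (integrable_star_dotProduct (h.memLp_output a b) (h.memLp_input a b)).re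

theorem IsTrajectory.intervalIntegrable_re_star_dotProduct_mulVec_stateDeriv
    (h : M.IsTrajectory x u) (X : Matrix (Fin n) (Fin n) ℂ) (hab : a ≤ b) :
    IntervalIntegrable (fun t => (star (x t) ⬝ᵥ X *ᵥ (M.A *ᵥ x t + M.B *ᵥ u t)).re) volume a b :=
  (intervalIntegrable_iff_integrableOn_Icc_of_le hab).mpr (integrable_star_dotProduct
    (h.memLp_state a b) (memLp_mulVec (h.memLp_stateDeriv a b) X)).re

theorem IsTrajectory.integral_re_star_dotProduct_mulVec_stateDeriv (h : M.IsTrajectory x u)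
    {X : Matrix (Fin n) (Fin n) ℂ} (hX : X.IsHermitian) (hab : a ≤ b) :
    ∫ t in a..b, (star (x t) ⬝ᵥ X *ᵥ (M.A *ᵥ x t + M.B *ᵥ u t)).re
      = storedEnergy X (x b) - storedEnergy X (x a) := by
  simp only [← fderiv_storedEnergy hX]
  exact integral_fderiv_comp_of_eq_primitive (contDiff_storedEnergy X)
    (h.intervalIntegrable_stateDeriv hab) fun t => eq_add_of_sub_eq' (h.state_eq a t)

theorem isPassive_of_posSemidef_W {X : Matrix (Fin n) (Fin n) ℂ} (hX : X.PosSemidef)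
    (hW : (M.W X).PosSemidef) : M.IsPassive := by
  refine ⟨storedEnergy X, fun z => ?_, fun x u h t₀ t₁ ht => ?_⟩
  · exact mul_nonneg (by norm_num) ((posSemidef_iff_re_nonneg.mp hX).2 z)
  rw [← h.integral_re_star_dotProduct_mulVec_stateDeriv hX.1 ht.le]
  refine intervalIntegral.integral_mono_on ht.le
    (h.intervalIntegrable_re_star_dotProduct_mulVec_stateDeriv X ht.le)
    (h.intervalIntegrable_supply ht.le) fun t _ => ?_
  have hdiss := (posSemidef_iff_re_nonneg.mp hW).2 (Sum.elim (x t) (u t))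
  rw [M.re_star_dotProduct_W_mulVec hX.1] at hdiss
  rw [output]
  linarith

end Passivity

section Minimality

variable {X : Matrix (Fin n) (Fin n) ℂ}

theorem mulVec_A_eq_zero_and_mulVec_C_eq_zero (hX : X.IsHermitian) (hW : (M.W X).PosSemidef)
    {v : Fin n → ℂ} (hv : X *ᵥ v = 0) : X *ᵥ (M.A *ᵥ v) = 0 ∧ M.C *ᵥ v = 0 := by
  have hquad : (star (Sum.elim v 0) ⬝ᵥ M.W X *ᵥ Sum.elim v 0).re = 0 := by
    rw [M.re_star_dotProduct_W_mulVec hX, re_star_dotProduct_mulVec_comm hX, hv]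
    simp only [dotProduct_zero, Complex.zero_re, mul_zero, sub_zero]
  have hzero := mulVec_eq_zero_of_re_star_dotProduct_eq_zero hW hquad
  rw [W, fromBlocks_mulVec] at hzero
  simp only [Sum.elim_comp_inl, Sum.elim_comp_inr, mulVec_zero, add_zero, sub_mulVec, neg_mulVec,
    ← mulVec_mulVec, hv, neg_zero, zero_sub, sub_zero] at hzero
  exact ⟨neg_eq_zero.mp (funext fun i => congrFun hzero (Sum.inl i)),
    funext fun i => congrFun hzero (Sum.inr i)⟩

theorem posDef_of_observable (hobs : IsControllablePair M.Aᴴ M.Cᴴ) (hX : X.PosSemidef)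
    (hW : (M.W X).PosSemidef) : X.PosDef := by
  have hker : LinearMap.ker X.mulVecLin = ⊥ := hobs.eq_bot_of_invariant
    (fun v hv => (mulVec_A_eq_zero_and_mulVec_C_eq_zero hX.1 hW hv).1)
    (fun v hv => (mulVec_A_eq_zero_and_mulVec_C_eq_zero hX.1 hW hv).2)
  rw [hX.posDef_iff_isUnit, ← mulVec_injective_iff_isUnit]
  exact LinearMap.ker_eq_bot.mp hker

theorem linW_eq_W (X : Matrix (Fin n) (Fin n) ℂ) : M.linW X = W ⟨M.A, M.B, 0, 0⟩ X := by
  simp only [linW, LinearMap.coe_mk, AddHom.coe_mk, W, conjTranspose_zero, zero_sub, add_zero]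

theorem mulVec_B_eq_zero (hX : X.IsHermitian) (hW : (M.linW X).PosSemidef) (g : Fin m → ℂ) :
    X *ᵥ (M.B *ᵥ g) = 0 := by
  have hquad : (star (Sum.elim 0 g) ⬝ᵥ M.linW X *ᵥ Sum.elim 0 g).re = 0 := by
    rw [M.re_star_dotProduct_linW_mulVec hX, star_zero, zero_dotProduct, Complex.zero_re, mul_zero]
  have hzero := mulVec_eq_zero_of_re_star_dotProduct_eq_zero hW hquad
  rw [linW_eq_W, W, fromBlocks_mulVec] at hzero
  simp only [Sum.elim_comp_inl, Sum.elim_comp_inr, mulVec_zero, zero_add, conjTranspose_zero,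
    zero_sub, neg_mulVec, ← mulVec_mulVec] at hzero
  exact neg_eq_zero.mp (funext fun i => congrFun hzero (Sum.inl i))

theorem eq_zero_of_controllable (hctr : IsControllablePair M.A M.B) (hX : X.IsHermitian)
    (hW : (M.linW X).PosSemidef) : X = 0 := by
  have hker : LinearMap.ker X.mulVecLin = ⊤ := hctr.eq_top_of_invariant
    (fun v hv => (mulVec_A_eq_zero_and_mulVec_C_eq_zero (M := ⟨M.A, M.B, 0, 0⟩) hX
      (linW_eq_W X ▸ hW) hv).1)
    (mulVec_B_eq_zero hX hW)
  exact Matrix.toLin'.map_eq_zero_iff.mp (LinearMap.ker_eq_top.mp hker)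

theorem exists_re_trace_le_of_controllable (hctr : IsControllablePair M.A M.B) :
    ∃ R, ∀ X : Matrix (Fin n) (Fin n) ℂ, X.PosSemidef → (M.W X).PosSemidef → X.trace.re ≤ R := by
  obtain ⟨R, hR⟩ := exists_re_trace_le_of_recession (M.W 0) M.linW
    fun Z hZ => eq_zero_of_controllable hctr hZ.1
  exact ⟨R, fun X hX hW => hR X hX (M.W_eq_add_linW X ▸ hW)⟩

end Minimality

section Shift

variable {X : Matrix (Fin n) (Fin n) ℂ} {ξ ξ' : ℝ}

theorem shift_zero (M : LTISystem n m) : M.shift 0 = M := by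
  simp only [shift, zero_div, Complex.ofReal_zero, zero_smul, add_zero, sub_zero]

theorem W_shift (M : LTISystem n m) (ξ : ℝ) (X : Matrix (Fin n) (Fin n) ℂ) :
    (M.shift ξ).W X = M.W X - (ξ : ℂ) • fromBlocks X 0 0 1 := by
  rw [sub_eq_add_neg, fromBlocks_smul, fromBlocks_neg, W, W, fromBlocks_add]
  simp only [shift, conjTranspose_add, conjTranspose_sub, conjTranspose_smul, conjTranspose_one,
    Complex.star_def, Complex.conj_ofReal, Matrix.add_mul, Matrix.mul_add, smul_mul_assoc,
    mul_smul_comm, Matrix.one_mul, Matrix.mul_one, smul_zero, neg_zero, add_zero]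
  congr 1 <;> push_cast <;> module

theorem mem_xiSet_iff : ξ ∈ M.xiSet X ↔ ((M.shift ξ).W X).PosSemidef := by
  rw [W_shift]
  rfl

theorem W_shift_eq_add (M : LTISystem n m) (ξ ξ' : ℝ) (X : Matrix (Fin n) (Fin n) ℂ) :
    (M.shift ξ').W X = (M.shift ξ).W X + (ξ - ξ') • fromBlocks X 0 0 1 := by
  rw [W_shift, W_shift, ← Complex.coe_smul, Complex.ofReal_sub]
  module

theorem continuous_W_shift (M : LTISystem n m) :
    Continuous fun p : ℝ × Matrix (Fin n) (Fin n) ℂ => (M.shift p.1).W p.2 := by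
  unfold W shift
  fun_prop

theorem posDef_W_shift_of_lt (hX : X.PosDef) (h : ξ' < ξ) (hW : ((M.shift ξ).W X).PosSemidef) :
    ((M.shift ξ').W X).PosDef := by
  rw [M.W_shift_eq_add ξ]
  exact PosDef.posSemidef_add hW
    ((posDef_fromBlocks_zero_zero hX PosDef.one).smul (sub_pos.mpr h))

theorem posSemidef_W_shift_of_le (hX : X.PosSemidef) (h : ξ' ≤ ξ)
    (hW : ((M.shift ξ).W X).PosSemidef) : ((M.shift ξ').W X).PosSemidef := by
  rw [M.W_shift_eq_add ξ]
  exact hW.add ((posSemidef_fromBlocks_zero_zero hX PosSemidef.one).smul (sub_nonneg.mpr h))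

theorem exists_pos_posDef_W_shift (hX : X.IsHermitian) (hW : ((M.shift ξ).W X).PosDef) :
    ∃ ε > 0, ((M.shift (ξ - ε)).W X).PosDef ∧ ((M.shift (ξ + ε)).W X).PosDef := by
  obtain ⟨ε, hε, hminus, hplus⟩ :=
    exists_pos_posDef_add_smul hW (isHermitian_fromBlocks_zero_zero hX isHermitian_one)
  refine ⟨ε, hε, ?_, ?_⟩ <;> rw [M.W_shift_eq_add ξ]
  · rwa [sub_sub_cancel]
  · rwa [sub_add_cancel_left]

theorem exists_posDef_W_shift (M : LTISystem n m) (hX : X.PosDef) :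
    ∃ ξ, ((M.shift ξ).W X).PosDef := by
  obtain ⟨t, ht, hpos, -⟩ := exists_pos_posDef_add_smul
    (posDef_fromBlocks_zero_zero hX PosDef.one) (M.isHermitian_W hX.1)
  refine ⟨-t⁻¹, ?_⟩
  have hscale := hpos.smul (inv_pos.mpr ht)
  rw [M.W_shift_eq_add 0, shift_zero, zero_sub, neg_neg, add_comm]
  rwa [smul_add, inv_smul_smul₀ ht.ne'] at hscale

theorem le_of_posSemidef_W_shift (hm : 0 < m) (hW : ((M.shift ξ).W X).PosSemidef) :
    ξ ≤ ((M.Dᴴ + M.D) ⟨0, hm⟩ ⟨0, hm⟩).re := by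
  have hdiag := (Complex.le_def.mp (hW.diag_nonneg (i := Sum.inr ⟨0, hm⟩))).1
  rw [W_shift, W, Matrix.sub_apply, Matrix.smul_apply, fromBlocks_apply₂₂, fromBlocks_apply₂₂,
    one_apply_eq, smul_eq_mul, mul_one, Complex.zero_re, Complex.sub_re, Complex.ofReal_re] at hdiag
  exact sub_nonneg.mp hdiag

theorem isGreatest_xiStar (hm : 0 < m) (hX : X.PosDef) :
    IsGreatest (M.xiSet X) (M.xiStar X) := by
  have hset : M.xiSet X = {ξ | ((M.shift ξ).W X).PosSemidef} := Set.ext fun _ => mem_xiSet_iff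
  have hclosed : IsClosed (M.xiSet X) := by
    rw [hset]
    exact isClosed_setOf_posSemidef.preimage
      (M.continuous_W_shift.comp (continuous_id.prodMk continuous_const))
  obtain ⟨ξ, hξ⟩ := M.exists_posDef_W_shift hX
  have hbdd : BddAbove (M.xiSet X) :=
    ⟨_, fun ξ hξ => le_of_posSemidef_W_shift hm (mem_xiSet_iff.mp hξ)⟩
  exact ⟨hclosed.csSup_mem ⟨ξ, mem_xiSet_iff.mpr hξ.posSemidef⟩ hbdd, fun _ => le_csSup hbdd⟩

end Shift

section MaximalShift

variable {Ξ : ℝ}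

theorem IsMinimal.shift (hmin : M.IsMinimal) (ξ : ℝ) : (M.shift ξ).IsMinimal := by
  refine ⟨hmin.1.add_smul_one _, ?_⟩
  have hA : (M.shift ξ).Aᴴ = M.Aᴴ + ((ξ / 2 : ℝ) : ℂ) • 1 := by
    simp only [LTISystem.shift, conjTranspose_add, conjTranspose_smul, conjTranspose_one,
      Complex.star_def, Complex.conj_ofReal]
  rw [hA]
  exact hmin.2.add_smul_one _

/- The pairs `(ξ, X)` with `ξ` bounded below, `X ≥ 0` and `W(X, M_ξ) ≥ 0` form a compact set by
controllability, and observability turns `X ≥ 0` into `X > 0`. -/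
theorem exists_isGreatest_setOf_solSet_shift_nonempty (hm : 0 < m) (hmin : M.IsMinimal) :
    ∃ Ξ, IsGreatest {ξ | (M.shift ξ).solSet.Nonempty} Ξ := by
  obtain ⟨ξ₀, hξ₀⟩ := M.exists_posDef_W_shift PosDef.one
  obtain ⟨R, hR⟩ := exists_re_trace_le_of_controllable (hmin.shift ξ₀).1
  set d := ((M.Dᴴ + M.D) ⟨0, hm⟩ ⟨0, hm⟩).re
  have hmem {ξ : ℝ} {X : Matrix (Fin n) (Fin n) ℂ} (hξ : ξ₀ ≤ ξ) (hX : X.PosSemidef)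
      (hW : ((M.shift ξ).W X).PosSemidef) :
      (ξ, X) ∈ Set.Icc ξ₀ d ×ˢ {Z | Z.PosSemidef ∧ Z.trace.re ≤ R}
        ∩ {p | ((M.shift p.1).W p.2).PosSemidef} :=
    ⟨⟨⟨hξ, le_of_posSemidef_W_shift hm hW⟩, hX, hR X hX (posSemidef_W_shift_of_le hX hξ hW)⟩, hW⟩
  obtain ⟨⟨Ξ, Z⟩, ⟨⟨⟨hΞ, -⟩, hZ, -⟩, hWZ⟩, hmax⟩ :=
    ((isCompact_Icc.prod (isCompact_posSemidef_trace_le R)).inter_right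
      (isClosed_setOf_posSemidef.preimage M.continuous_W_shift)).exists_isMaxOn
      ⟨_, hmem le_rfl PosSemidef.one hξ₀.posSemidef⟩ continuousOn_fst
  refine ⟨Ξ, ⟨Z, posDef_of_observable (hmin.shift Ξ).2 hZ hWZ, hWZ⟩, ?_⟩
  rintro ξ ⟨X, hX, hW⟩
  rcases le_total ξ ξ₀ with hξ | hξ
  · exact hξ.trans hΞ
  · exact hmax (hmem hξ hX.posSemidef hW)

theorem isStrictlyPassive_shift_iff_lt (hΞ : IsGreatest {ξ | (M.shift ξ).solSet.Nonempty} Ξ)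
    (ξ : ℝ) : (M.shift ξ).IsStrictlyPassive ↔ ξ < Ξ := by
  rw [isStrictlyPassive_iff_strictSolSet_nonempty]
  constructor
  · rintro ⟨X, hX, hW⟩
    obtain ⟨ε, hε, -, hplus⟩ := exists_pos_posDef_W_shift hX.1 hW
    exact (lt_add_of_pos_right ξ hε).trans_le (hΞ.2 ⟨X, hX, hplus.posSemidef⟩)
  · intro hξ
    obtain ⟨X, hX, hW⟩ := hΞ.1
    exact ⟨X, hX, posDef_W_shift_of_lt hX hξ hW⟩

/- A strict Hermitian solution at `Ξ` would persist at `Ξ - ε`, where stability makes it positive,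
and at `Ξ + ε`, where it would contradict maximality. -/
theorem not_posDef_W_shift (hΞ : IsGreatest {ξ | (M.shift ξ).solSet.Nonempty} Ξ)
    {X : Matrix (Fin n) (Fin n) ℂ} (hX : X.IsHermitian) : ¬((M.shift Ξ).W X).PosDef := by
  intro hW
  obtain ⟨ε, hε, hminus, hplus⟩ := exists_pos_posDef_W_shift hX hW
  have hstable : (M.shift (Ξ - ε)).IsAsymptoticallyStable :=
    ((isStrictlyPassive_shift_iff_lt hΞ _).mpr (sub_lt_self Ξ hε)).1
  have hXpos : X.PosDef := posDef_of_posDef_W hstable hX hminus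
  exact (lt_add_of_pos_right Ξ hε).not_ge (hΞ.2 ⟨X, hXpos, hplus.posSemidef⟩)

theorem isGreatest_image_xiStar (hm : 0 < m)
    (hΞ : IsGreatest {ξ | (M.shift ξ).solSet.Nonempty} Ξ) :
    IsGreatest (M.xiStar '' {X | X.PosDef}) Ξ := by
  have hle : ∀ X : Matrix (Fin n) (Fin n) ℂ, X.PosDef → M.xiStar X ≤ Ξ := fun X hX =>
    hΞ.2 ⟨X, hX, mem_xiSet_iff.mp (isGreatest_xiStar hm hX).1⟩
  obtain ⟨X, hX, hW⟩ := hΞ.1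
  refine ⟨⟨X, hX, (hle X hX).antisymm ((isGreatest_xiStar hm hX).2 (mem_xiSet_iff.mpr hW))⟩, ?_⟩
  rintro _ ⟨Y, hY, rfl⟩
  exact hle Y hY

theorem isGreatest_image_xiStar_solSet (hm : 0 < m)
    (hΞ : IsGreatest (M.xiStar '' {X | X.PosDef}) Ξ) (h0 : 0 ≤ Ξ) :
    IsGreatest (M.xiStar '' M.solSet) Ξ := by
  refine ⟨?_, upperBounds_mono_set (Set.image_mono fun _ hX => hX.1) hΞ.2⟩
  obtain ⟨X, hX, rfl⟩ := hΞ.1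
  refine ⟨X, ⟨hX, ?_⟩, rfl⟩
  have hW := mem_xiSet_iff.mp (isGreatest_xiStar (M := M) hm hX).1
  simpa only [shift_zero] using posSemidef_W_shift_of_le hX.posSemidef h0 hW

end MaximalShift

end LTISystem

theorem mainTheorem4_general {n m : ℕ} (hm : 0 < m) (M : LTISystem n m) (hmin : M.IsMinimal) :
    ∃ Ξ : ℝ,
      IsLUB {ξ : ℝ | (M.shift ξ).IsStrictlyPassive} Ξ ∧
      (M.shift Ξ).IsPassive ∧
      (M.shift Ξ).solSet.Nonempty ∧
      (¬ ∃ X : Matrix (Fin n) (Fin n) ℂ, X.IsHermitian ∧ ((M.shift Ξ).W X).PosDef) ∧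
      (∀ ξ : ℝ, ξ < Ξ → (M.shift ξ).strictSolSet.Nonempty) ∧
      (∀ X : Matrix (Fin n) (Fin n) ℂ, X.PosDef → IsGreatest (M.xiSet X) (M.xiStar X)) ∧
      IsGreatest (M.xiStar '' {X | X.PosDef}) Ξ := by
  obtain ⟨Ξ, hΞ⟩ := LTISystem.exists_isGreatest_setOf_solSet_shift_nonempty hm hmin
  have hlt := LTISystem.isStrictlyPassive_shift_iff_lt hΞ
  obtain ⟨X, hX, hW⟩ := hΞ.1
  refine ⟨Ξ, ?_, LTISystem.isPassive_of_posSemidef_W hX.posSemidef hW, ⟨X, hX, hW⟩, ?_,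
    fun ξ hξ => LTISystem.isStrictlyPassive_iff_strictSolSet_nonempty.mp ((hlt ξ).mpr hξ),
    fun _ => LTISystem.isGreatest_xiStar hm, LTISystem.isGreatest_image_xiStar hm hΞ⟩
  · have hset : {ξ | (M.shift ξ).IsStrictlyPassive} = Set.Iio Ξ := Set.ext hlt
    exact hset ▸ isLUB_Iio
  · exact fun ⟨Y, hY, hWY⟩ => LTISystem.not_posDef_W_shift hΞ hY hWY

theorem mainTheorem4 {n m : ℕ} (hm : 0 < m) (M : LTISystem n m)
    (hmin : M.IsMinimal) (hM : M.IsStrictlyPassive) :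
    ∃ Ξ : ℝ,
      IsLUB {ξ : ℝ | (M.shift ξ).IsStrictlyPassive} Ξ ∧
      (M.shift Ξ).IsPassive ∧
      (M.shift Ξ).solSet.Nonempty ∧
      (¬ ∃ X : Matrix (Fin n) (Fin n) ℂ, X.IsHermitian ∧ ((M.shift Ξ).W X).PosDef) ∧
      (∀ ξ : ℝ, ξ < Ξ → (M.shift ξ).strictSolSet.Nonempty) ∧
      (∀ X ∈ M.solSet, IsGreatest (M.xiSet X) (M.xiStar X)) ∧
      IsLUB (M.xiStar '' M.solSet) Ξ := by
  obtain ⟨Ξ, hsup, hpassive, hsol, hnone, hstrict, hmax, hΞ⟩ := mainTheorem4_general hm M hmin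
  have h0 : 0 ≤ Ξ := hsup.1 (show (M.shift 0).IsStrictlyPassive by rwa [LTISystem.shift_zero])
  exact ⟨Ξ, hsup, hpassive, hsol, hnone, hstrict, fun X hX => hmax X hX.1,
    (LTISystem.isGreatest_image_xiStar_solSet hm hΞ h0).isLUB⟩
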